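/- All graphs are finite and simple. The spectrum of a graph is the multiset of eigenvalues of its adjacency matrix; a cospectral mate of $G$ is a graph with the same spectrum as $G$ that is not isomorphic to $G$; $G$ is DS (determined by its spectrum) if it has no cospectral mate. Cospectral mates are counted up to isomorphism, $\cup$ denotes disjoint union and $mG$ the disjoint union of $m$ copies of $G$. Notation. ${\cal S}_{2k+1}$ is the subdivision of the star $K_{1,k}$ (a new vertex is inserted on every edge). ${\cal L}_{k,k}$ is $K_{k,k}$ minus a perfect matching, and ${\cal H}_{k,k+1}$ is obtained from ${\cal L}_{k,k}$ by adding a new vertex joined to all vertices of one part. A bipartite graph has bipartite adjacency matrix $N$ if its adjacency matrix is $\begin{pmatrix} O & N\\ N^\top & O\end{pmatrix}$ for a suitable ordering of the vertices. Let $I_m$ be the identity matrix, $J$ an all-ones matrix ($J_m$ if it is $m\times m$), ${\bf 1}$ an all-ones column vector, and $\widetilde{I_m}=(I_m\ {\bf 1})$. For $k\ge 3$, ${\cal R}_{2k+1}$ and ${\cal Q}_{2k+1}$ are the bipartite graphs with bipartite adjacency matrices $$\begin{pmatrix} I_{k-3} & J\\ O & \widetilde{I_3}\end{pmatrix}_{k\times(k+1)},\qquad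 \begin{pmatrix}\widetilde{I_{k-3}} & J\\ O & J_3-I_3\end{pmatrix}_{k\times (k+1)},$$ and $G_1,G_2,G_3,G_4$ are the bipartite graphs with bipartite adjacency matrices $$\begin{pmatrix}1&{\bf 1}^\top\\ {\bf 1}& I_4\end{pmatrix},\quad \begin{pmatrix}J_3-I_3&J_3\\ O&J_3-I_3\end{pmatrix},\quad \begin{pmatrix}J_4-I_4&J_{4\times 2}\\ O&J_{1\times 2}\end{pmatrix},\quad \begin{pmatrix}J_3-I_3&J_3\\ O&\widetilde{I_2}\end{pmatrix}.$$ Theorem. Let $$S=\{4\ell+3\mid \ell\ge 0\}\cup\{\ell^2-1\mid \ell\ge 2\}\cup\{\ell^2-\ell\mid \ell\ge 3\}\cup\{14,17\}.$$ For every integer $k\ge 1$, the graph ${\cal S}_{2k+1}$ is DS if and only if $k\notin S$. Moreover, for $k\in S$ the cospectral mates are as follows (the graphs listed in each item being pairwise non-isomorphic): - ${\cal S}_{7}$ has exactly one cospectral mate, ${\cal L}_{3,3}\cup K_1$; - ${\cal S}_{17}$ has exactly two cospectral mates, ${\cal L}_{4,4}\cup 4K_2\cup K_1$ and $G_1\cup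 3K_2\cup K_1$; - ${\cal S}_{29}$ has exactly one cospectral mate, $G_4\cup 9K_2$; - ${\cal S}_{31}$ has exactly four cospectral mates, $G_2\cup 9K_2\cup K_1$, ${\cal L}_{5,5}\cup 10K_2\cup K_1$, ${\cal R}_{13}\cup 9K_2$ and ${\cal Q}_{13}\cup 9K_2$; - ${\cal S}_{35}$ has exactly one cospectral mate, $G_3\cup 12K_2$; - if $k=4\ell+3$ with $\ell\ge 0$ and $\ell$ is not of the form $t^2-1$ with $t$ an integer, then ${\cal S}_{2k+1}$ has exactly two cospectral mates, ${\cal R}_{2\ell+7}\cup 3\ell K_2$ and ${\cal Q}_{2\ell+7}\cup 3\ell K_2$; - if $k=\ell^2-1$ with $\ell=2t\ge 2$ and $k\notin\{3,15\}$, then ${\cal S}_{2k+1}$ has exactly three cospectral mates, ${\cal L}_{\ell+1,\ell+1}\cup(k-\ell-1)K_2\cup K_1$, ${\cal R}_{2t^2+5}\cup 3(t^2-1)K_2$ and ${\cal Q}_{2t^2+5}\cup 3(t^2-1)K_2$; - if $k=\ell^2-1$ with $\ell\ge 2$ odd and $k\ne 8$, then ${\cal S}_{2k+1}$ has exactly one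 cospectral mate, ${\cal L}_{\ell+1,\ell+1}\cup(k-\ell-1)K_2\cup K_1$; - if $k=\ell^2-\ell$ with $\ell\ge 3$, then ${\cal S}_{2k+1}$ has exactly one cospectral mate, ${\cal H}_{\ell,\ell+1}\cup(k-\ell)K_2$. -/

import Mathlib

/-- A finite simple graph, bundled with its vertex type. -/
structure FinGraph where
  V : Type
  [fintypeV : Fintype V]
  graph : SimpleGraph V

namespace FinGraph

attribute [instance] FinGraph.fintypeV

/-- Two graphs are isomorphic. -/
def Iso (A B : FinGraph) : Prop := Nonempty (A.graph ≃g B.graph)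

open Classical in
/-- The spectrum of a graph: the multiset of eigenvalues (with multiplicity) of its adjacency
matrix. -/
noncomputable def spec (A : FinGraph) : Multiset ℝ :=
  (A.graph.adjMatrix ℝ).charpoly.roots

/-- `B` is a cospectral mate of `A`: same spectrum, but not isomorphic. -/
def IsMate (B A : FinGraph) : Prop := B.spec = A.spec ∧ ¬ B.Iso A

/-- `A` is determined by its spectrum: every graph with the same spectrum is isomorphic to it. -/
def IsDS (A : FinGraph) : Prop := ∀ B : FinGraph, B.spec = A.spec → B.Iso A

/-- Up to isomorphism, the cospectral mates of `A` are exactly the members of the list `L`, and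
these are pairwise non-isomorphic (so that `A` has exactly `L.length` cospectral mates). -/
def HasExactlyMates (A : FinGraph) (L : List FinGraph) : Prop :=
  L.Pairwise (fun B C => ¬ B.Iso C) ∧ ∀ B : FinGraph, B.IsMate A ↔ ∃ C ∈ L, B.Iso C

/-- `A + B` is the disjoint union of `A` and `B`. -/
instance : Add FinGraph := ⟨fun A B => ⟨A.V ⊕ B.V, A.graph ⊕g B.graph⟩⟩

/-- `m • A` is the disjoint union of `m` copies of `A`. -/
instance : SMul ℕ FinGraph := ⟨fun m A => ⟨Fin m × A.V,
  { Adj := fun p q => p.1 = q.1 ∧ A.graph.Adj p.2 q.2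
    symm := ⟨fun _ _ h => ⟨h.1.symm, h.2.symm⟩⟩
    loopless := ⟨fun _ h => A.graph.irrefl h.2⟩ }⟩⟩

/-- The one-vertex graph. -/
def K1 : FinGraph := ⟨Fin 1, ⊤⟩

/-- The complete graph on two vertices. -/
def K2 : FinGraph := ⟨Fin 2, ⊤⟩

open Classical in
/-- The subdivision of a graph: a new vertex is inserted on every edge. -/
noncomputable def subdivision (A : FinGraph) : FinGraph :=
  ⟨A.V ⊕ A.graph.edgeSet,
    SimpleGraph.fromRel fun x y => ∃ (v : A.V) (e : A.graph.edgeSet),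
      x = Sum.inl v ∧ y = Sum.inr e ∧ v ∈ (e : Sym2 A.V)⟩

/-- The graph `S_{2k+1}`: the subdivision of the star `K_{1,k}`. -/
noncomputable def graphS (k : ℕ) : FinGraph :=
  subdivision ⟨Fin 1 ⊕ Fin k, completeBipartiteGraph (Fin 1) (Fin k)⟩

/-- The bipartite graph with bipartite adjacency matrix `N` (a 0-1 matrix). -/
def ofBipartite {α β : Type} [Fintype α] [Fintype β] (N : Matrix α β ℤ) : FinGraph :=
  ⟨α ⊕ β, SimpleGraph.fromRel fun x y => ∃ (a : α) (b : β),
    x = Sum.inl a ∧ y = Sum.inr b ∧ N a b = 1⟩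

/-- The all-ones matrix. -/
def J (α β : Type) : Matrix α β ℤ := Matrix.of fun _ _ => 1

/-- `J_m - I_m`. -/
def JsubI (m : ℕ) : Matrix (Fin m) (Fin m) ℤ := J (Fin m) (Fin m) - 1

/-- The identity matrix extended by an all-ones column. -/
def extI (m : ℕ) : Matrix (Fin m) (Fin m ⊕ Fin 1) ℤ := Matrix.fromCols 1 (J (Fin m) (Fin 1))

/-- `L_{k,k}`: the complete bipartite graph `K_{k,k}` minus a perfect matching. -/
def graphL (k : ℕ) : FinGraph := ofBipartite (JsubI k)

/-- `H_{k,k+1}`: a new vertex is added to `L_{k,k}` and joined to all vertices of one part. -/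
def graphH (k : ℕ) : FinGraph :=
  ofBipartite (Matrix.fromCols (JsubI k) (J (Fin k) (Fin 1)))

/-- The graph `R_{2k+1}`, for `3 ≤ k`. -/
def graphR (k : ℕ) : FinGraph :=
  ofBipartite (Matrix.fromBlocks (1 : Matrix (Fin (k - 3)) (Fin (k - 3)) ℤ) (J _ _) 0 (extI 3))

/-- The graph `Q_{2k+1}`, for `3 ≤ k`. -/
def graphQ (k : ℕ) : FinGraph :=
  ofBipartite (Matrix.fromBlocks (extI (k - 3)) (J _ _) 0 (JsubI 3))

/-- The graph `G_1`, of order 10. -/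
def graphG1 : FinGraph :=
  ofBipartite (Matrix.fromBlocks (J (Fin 1) (Fin 1)) (J _ _) (J _ _)
    (1 : Matrix (Fin 4) (Fin 4) ℤ))

/-- The graph `G_2`, of order 12. -/
def graphG2 : FinGraph :=
  ofBipartite (Matrix.fromBlocks (JsubI 3) (J _ _) 0 (JsubI 3))

/-- The graph `G_3`, of order 11. -/
def graphG3 : FinGraph :=
  ofBipartite (Matrix.fromBlocks (JsubI 4) (J _ _) 0 (J (Fin 1) (Fin 2)))

/-- The graph `G_4`, of order 11. -/
def graphG4 : FinGraph :=
  ofBipartite (Matrix.fromBlocks (JsubI 3) (J _ _) 0 (extI 2))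

/-- The set of those `k ≥ 1` for which `S_{2k+1}` is not determined by its spectrum. -/
def exceptionalSet : Set ℕ :=
  {k | ∃ l : ℕ, k = 4 * l + 3} ∪ {k | ∃ l : ℕ, 2 ≤ l ∧ k = l ^ 2 - 1} ∪
    {k | ∃ l : ℕ, 3 ≤ l ∧ k = l ^ 2 - l} ∪ {14, 17}

end FinGraph

namespace FinGraph

open Sum

/-! ### Isomorphism and the spectrum -/

/-! A graph cospectral to the subdivided star is bipartite, because the numbers of closed walks of
odd length are traces of powers and hence spectral. Let `N` be its bipartite adjacency matrix, with
no more rows than columns. For the star itself `N Nᵀ = I + J`, with eigenvalue `k + 1` once and `1`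
otherwise. So `0` is a simple eigenvalue of the graph, which forces `N` to have size `k × (k + 1)`,
and `N Nᵀ - I` is positive semidefinite of rank one with trace `k`. Reading the rows of `N` as sets,
this says that `|A ∩ B|² = (|A| - 1)(|B| - 1)` for distinct rows and that the sizes sum to `2k`.
This is `RowCond`, and it is equivalent to cospectrality (`spec_eq_graphS_iff`).

The rest is combinatorics of sets. A singleton row is disjoint from all other rows, hence a
component `K₂`. Since an intersection is no larger than either set, `eq_or_one_four_of_mul_eq_sq`
leaves two possibilities for the other rows: all have the same size `n + 1`, or their sizes are `2`
and `5` and every `2`-row lies in every `5`-row. Rows of equal size `n + 1` meet pairwise in `n`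
points, so they either share an `n`-point kernel or are complements of points in an `(n + 2)`-set
(`sunflower_or_clique`).

As there are `k` rows and `k + 1` points, the rows that are not singletons cover at most one point
more than their number (`RowCond.card_add_card_le`). In the uniform case this leaves the star, `L`
and `H`; with sizes `2` and `5` it leaves `R`, `Q` and the sporadic `G₁`, ..., `G₄`. All of them are
instances of one parametrised family, `stdRows`, so a single computation of row sizes and
intersections gives the converse.

It remains to see which families share a value of `k`, which is elementary arithmetic, and to
separate the graphs by isolated vertices, `K₂` components and degrees of adjacent vertices. -/

theorem Iso.refl (A : FinGraph) : A.Iso A := ⟨SimpleGraph.Iso.refl⟩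

theorem Iso.symm {A B : FinGraph} : A.Iso B → B.Iso A := fun ⟨e⟩ => ⟨e.symm⟩

theorem Iso.trans {A B C : FinGraph} : A.Iso B → B.Iso C → A.Iso C := fun ⟨e⟩ ⟨f⟩ => ⟨e.trans f⟩

theorem Iso.of_equiv {V W : Type} [Fintype V] [Fintype W] {G : SimpleGraph V} {H : SimpleGraph W}
    (e : V ≃ W) (h : ∀ x y, H.Adj (e x) (e y) ↔ G.Adj x y) : Iso ⟨V, G⟩ ⟨W, H⟩ :=
  ⟨⟨e, fun {x y} => h x y⟩⟩

open Classical in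
theorem spec_eq_of_iso {A B : FinGraph} (h : A.Iso B) : A.spec = B.spec := by
  obtain ⟨e⟩ := h
  unfold spec
  rw [← Matrix.charpoly_reindex e.toEquiv]
  congr 2
  ext x y
  simp only [Matrix.reindex_apply, Matrix.submatrix_apply, SimpleGraph.adjMatrix_apply]
  have := e.symm.map_adj_iff (v := x) (w := y)
  exact if_congr this rfl rfl

/-! ### Bipartite graphs given by a relation -/

/-- The adjacency relation of the bipartite graph given by a relation. -/
def bipAdj {α β : Type} (R : α → β → Prop) : α ⊕ β → α ⊕ β → Prop
  | inl a, inr b => R a b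
  | inr b, inl a => R a b
  | inl _, inl _ => False
  | inr _, inr _ => False

/-- The bipartite graph with parts `α` and `β` and adjacency given by `R`. -/
def bipGraph {α β : Type} (R : α → β → Prop) : SimpleGraph (α ⊕ β) where
  Adj := bipAdj R
  symm := ⟨by rintro (a | b) (a' | b') h <;> exact h⟩
  loopless := ⟨by rintro (a | b) h <;> exact h⟩

/-- The finite bipartite graph with parts `α` and `β` and adjacency given by `R`. -/
def bip {α β : Type} [Fintype α] [Fintype β] (R : α → β → Prop) : FinGraph :=
  ⟨α ⊕ β, bipGraph R⟩

theorem bipGraph_adj {α β : Type} (R : α → β → Prop) (x y : α ⊕ β) :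
    (bipGraph R).Adj x y ↔ bipAdj R x y := Iff.rfl

section bip

variable {α β α' β' : Type} [Fintype α] [Fintype β] [Fintype α'] [Fintype β']

theorem bip_iso_of_equiv {R : α → β → Prop} {R' : α' → β' → Prop} (e : α ≃ α') (f : β ≃ β')
    (h : ∀ a b, R' (e a) (f b) ↔ R a b) : (bip R).Iso (bip R') := by
  refine Iso.of_equiv (Equiv.sumCongr e f) ?_
  rintro (a | b) (a' | b') <;> simp [bipGraph_adj, bipAdj, h]

theorem bip_iso_swap (R : α → β → Prop) : (bip R).Iso (bip fun b a => R a b) := by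
  refine Iso.of_equiv (Equiv.sumComm α β) ?_
  rintro (a | b) (a' | b') <;> simp [bipGraph_adj, bipAdj]

theorem ofBipartite_iso_bip (N : Matrix α β ℤ) : (ofBipartite N).Iso (bip fun a b => N a b = 1) := by
  refine Iso.of_equiv (Equiv.refl _) ?_
  rintro (a | b) (a' | b') <;> simp [bipGraph_adj, bipAdj]

/-- The relation of a disjoint union of bipartite graphs. -/
def sumRel (R : α → β → Prop) (R' : α' → β' → Prop) : α ⊕ α' → β ⊕ β' → Prop
  | inl a, inl b => R a b
  | inr a, inr b => R' a b
  | inl _, inr _ => False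
  | inr _, inl _ => False

theorem bip_add_iso (R : α → β → Prop) (R' : α' → β' → Prop) :
    (bip R + bip R').Iso (bip (sumRel R R')) := by
  refine Iso.of_equiv (G := bipGraph R ⊕g bipGraph R') (Equiv.sumSumSumComm α β α' β') ?_
  rintro ((a | b) | (a | b)) ((a' | b') | (a' | b')) <;>
    simp [bipGraph_adj, bipAdj, sumRel]
end bip

theorem Iso.add {A B A' B' : FinGraph} : A.Iso A' → B.Iso B' → (A + B).Iso (A' + B') := by
  rintro ⟨e⟩ ⟨f⟩
  refine Iso.of_equiv (G := A.graph ⊕g B.graph) (H := A'.graph ⊕g B'.graph)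
    (Equiv.sumCongr e.toEquiv f.toEquiv) ?_
  rintro (a | b) (a' | b')
  · exact e.map_adj_iff
  · exact Iff.rfl
  · exact Iff.rfl
  · exact f.map_adj_iff

theorem K1_iso_bip : K1.Iso (bip fun (_ : Fin 0) (_ : Fin 1) => False) := by
  refine Iso.of_equiv (Equiv.emptySum (Fin 0) (Fin 1)).symm ?_
  intro x y
  simp [Subsingleton.elim x y]

theorem smul_K2_iso_bip (m : ℕ) : (m • K2).Iso (bip fun (i j : Fin m) => j = i) := by
  refine Iso.symm (Iso.of_equiv (V := Fin m ⊕ Fin m) (W := Fin m × Fin 2)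
    (Equiv.ofBijective (Sum.elim (fun i => ((i, 0) : Fin m × Fin 2)) (fun i => (i, 1))) ?_) ?_)
  · rw [Fintype.bijective_iff_injective_and_card]
    constructor
    · rintro (a | b) (a' | b') <;> simp
    · simp; omega
  · have hK : ∀ i j : Fin 2, K2.graph.Adj i j ↔ i ≠ j := fun _ _ => Iff.rfl
    rintro (a | b) (a' | b') <;>
      simp [bipGraph_adj, bipAdj, hK, eq_comm]

theorem subdivision_adj_inl_inr (A : FinGraph) (v : A.V) (e : A.graph.edgeSet) :
    (subdivision A).graph.Adj (Sum.inl v) (Sum.inr e) ↔ v ∈ (e : Sym2 A.V) := by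
  simp [subdivision]

theorem not_subdivision_adj_inl_inl (A : FinGraph) (v w : A.V) :
    ¬ (subdivision A).graph.Adj (Sum.inl v) (Sum.inl w) := by
  simp [subdivision]

theorem not_subdivision_adj_inr_inr (A : FinGraph) (e f : A.graph.edgeSet) :
    ¬ (subdivision A).graph.Adj (Sum.inr e) (Sum.inr f) := by
  simp [subdivision]

/-- The inserted vertices form one part, indexed by the leaves. In the other part `none` is the
centre of the star and `some i` is the leaf `i`. -/
theorem graphS_iso_bip (k : ℕ) :
    (graphS k).Iso (bip fun (i : Fin k) (c : Option (Fin k)) => c = some i ∨ c = none) := by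
  classical
  have hadj : ∀ i : Fin k, s(Sum.inl 0, Sum.inr i) ∈
      (completeBipartiteGraph (Fin 1) (Fin k)).edgeSet := by intro i; simp
  let E := (completeBipartiteGraph (Fin 1) (Fin k)).edgeSet
  let φ : Fin k ⊕ Option (Fin k) → (Fin 1 ⊕ Fin k) ⊕ E :=
    Sum.elim (fun i => Sum.inr ⟨_, hadj i⟩) (fun c => Sum.inl (c.elim (Sum.inl 0) Sum.inr))
  refine Iso.symm (Iso.of_equiv (V := Fin k ⊕ Option (Fin k)) (W := (Fin 1 ⊕ Fin k) ⊕ E)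
    (Equiv.ofBijective φ ?_) ?_)
  · constructor
    · rintro (a | (_ | b)) (a' | (_ | b')) <;> simp [φ]
    · rintro ((v | v) | ⟨e, he⟩)
      · exact ⟨Sum.inr none, by simp [φ, Subsingleton.elim v 0]⟩
      · exact ⟨Sum.inr (some v), by simp [φ]⟩
      · change e ∈ (completeBipartiteGraph (Fin 1) (Fin k)).edgeSet at he
        induction e with | _ x y
        rcases x with x | x <;> rcases y with y | y
        · simp [SimpleGraph.mem_edgeSet] at he
        · exact ⟨Sum.inl y, by simp [φ, Subsingleton.elim x 0]⟩
        · exact ⟨Sum.inl x, by simp [φ, Subsingleton.elim y 0]⟩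
        · simp at he
  · have h1 (i : Fin k) (c : Option (Fin k)) :
        (graphS k).graph.Adj (φ (Sum.inr c)) (φ (Sum.inl i)) ↔ c = some i ∨ c = none := by
      refine (subdivision_adj_inl_inr _ _ _).trans ?_
      rcases c with _ | c <;> simp
    rintro (a | b) (a' | b')
    · exact iff_of_false (not_subdivision_adj_inr_inr _ _ _) id
    · exact (SimpleGraph.adj_comm _ _ _).trans (h1 a b')
    · exact h1 a' b
    · exact iff_of_false (not_subdivision_adj_inl_inl _ _ _) id


open Polynomial Matrix Finset

/-! ### Linear algebra -/

/-- Block elimination without division: the product of `(x, -N; -M, x)` and `(x, 0; M, 1)` is block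
triangular with diagonal blocks `x² - N M` and `x`. Taking determinants gives the identity; `expand
R 2` is the substitution of `x²`. -/
theorem charpoly_fromBlocks_zero_mul {m n R : Type*} [CommRing R] [Fintype m] [Fintype n]
    [DecidableEq m] [DecidableEq n] (N : Matrix m n R) (M : Matrix n m R) :
    (fromBlocks 0 N M 0).charpoly * X ^ Fintype.card m =
      X ^ Fintype.card n * expand R 2 (N * M).charpoly := by
  have h1 : (fromBlocks 0 N M 0).charmatrix *
      fromBlocks (scalar m (X : R[X])) 0 (M.map C) 1 =
      fromBlocks ((N * M).charmatrix.map (expand R 2)) (-N.map C) 0 (scalar n (X : R[X])) := by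
    rw [charmatrix_fromBlocks, fromBlocks_multiply]
    congr 1
    · ext i j
      by_cases h : i = j
      · subst h
        simp [charmatrix, Matrix.mul_apply, sq, sub_eq_add_neg]
      · simp [charmatrix, Matrix.mul_apply, h, sub_eq_add_neg]
    · simp
    · rw [charmatrix_zero, scalar_comm _ (fun _ => Commute.all _ _)]
      simp
    · simp [charmatrix]
  have h2 := congrArg det h1
  rw [det_mul, det_fromBlocks_zero₁₂, det_fromBlocks_zero₂₁] at h2
  have h3 : ((N * M).charmatrix.map (expand R 2)).det = expand R 2 (N * M).charpoly := by
    rw [Matrix.charpoly, AlgHom.map_det]; rfl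
  rw [h3] at h2
  simp only [det_one, mul_one] at h2
  rw [Matrix.charpoly]
  simpa [mul_comm] using h2

theorem trace_pow_eq_sum_roots {n : Type*} [Fintype n] [DecidableEq n] {A : Matrix n n ℝ}
    (hA : A.IsHermitian) (m : ℕ) : (A ^ m).trace = (A.charpoly.roots.map (· ^ m)).sum := by
  rw [hA.roots_charpoly_eq_eigenvalues]
  conv_lhs => rw [hA.spectral_theorem, ← map_pow, Unitary.conjStarAlgAut_apply,
    trace_mul_comm, ← mul_assoc]
  simp [diagonal_pow, trace_diagonal]

theorem charpoly_eq_iff_roots_eq {m n : Type*} [Fintype m] [DecidableEq m] [Fintype n]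
    [DecidableEq n] {A : Matrix m m ℝ} {B : Matrix n n ℝ} (hA : A.IsHermitian)
    (hB : B.IsHermitian) : A.charpoly.roots = B.charpoly.roots ↔ A.charpoly = B.charpoly := by
  refine ⟨fun h => ?_, fun h => by rw [h]⟩
  rw [hA.splits_charpoly.eq_prod_roots_of_monic (charpoly_monic A),
    hB.splits_charpoly.eq_prod_roots_of_monic (charpoly_monic B), h]

/-- The characteristic polynomial of `1 + w wᵀ` where `w` has length `k` and squared norm `k`. -/
theorem charpoly_one_add_vecMulVec {n : Type*} [Fintype n] [DecidableEq n] (w : n → ℝ) :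
    (1 + vecMulVec w w).charpoly =
      (X ^ Fintype.card n - C (w ⬝ᵥ w) * X ^ (Fintype.card n - 1)).comp (X - C 1) := by
  have := charpoly_sub_scalar (vecMulVec w w) (-1)
  rw [charpoly_vecMulVec, smul_eq_C_mul] at this
  simp only [C_neg, ← sub_eq_add_neg] at this
  rw [← this]
  congr 1
  ext i j
  by_cases h : i = j
  · subst h; simp [add_comm]
  · simp [h]

/-- The eigenvalues are `c` once and `0` otherwise, so only one term of the spectral decomposition
survives; `u` is the corresponding column of the eigenvector matrix. -/
theorem exists_rank_one_of_charpoly {n : Type*} [Fintype n] [DecidableEq n] {E : Matrix n n ℝ}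
    (hE : E.IsHermitian) {c : ℝ} (hc : 0 < c) (hn : 1 ≤ Fintype.card n)
    (h : E.charpoly = X ^ Fintype.card n - C c * X ^ (Fintype.card n - 1)) :
    ∃ u : n → ℝ, ∑ i, u i * u i = 1 ∧ ∀ i j, E i j = c * (u i * u j) := by
  have hroots : E.charpoly.roots = Multiset.replicate (Fintype.card n - 1) 0 + {c} := by
    have : E.charpoly = X ^ (Fintype.card n - 1) * (X - C c) := by
      rw [h, mul_sub, ← pow_succ, Nat.sub_add_cancel hn, mul_comm (C c)]
    rw [this, roots_mul, roots_X_pow, roots_X_sub_C, Multiset.nsmul_singleton]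
    exact mul_ne_zero (pow_ne_zero _ X_ne_zero) (X_sub_C_ne_zero c)
  have hev := hE.roots_charpoly_eq_eigenvalues
  rw [hroots] at hev
  have hmem : ∀ t, hE.eigenvalues t = 0 ∨ hE.eigenvalues t = c := by
    intro t
    have : hE.eigenvalues t ∈ Multiset.replicate (Fintype.card n - 1) 0 + {c} := by
      rw [hev]; simp
    simp only [Multiset.mem_add, Multiset.mem_singleton] at this
    exact this.imp (fun h => Multiset.eq_of_mem_replicate h) id
  -- As `c ≠ 0`, comparing the multiplicities of `c` shows that exactly one index carries it.
  have hcount := congrArg (Multiset.count c) hev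
  rw [Multiset.count_add, Multiset.count_replicate, if_neg hc.ne, Multiset.count_singleton_self,
    Multiset.count_map] at hcount
  have hcard : #{t | c = hE.eigenvalues t} = 1 := by
    rw [Finset.card_def, Finset.filter_val]; simpa using hcount.symm
  obtain ⟨t, ht⟩ := Finset.card_eq_one.mp hcard
  have ht' : ∀ s, c = hE.eigenvalues s ↔ s = t := by
    intro s
    have := Finset.ext_iff.mp ht s
    simpa using this
  have hzero : ∀ s, s ≠ t → hE.eigenvalues s = 0 := fun s hs =>
    (hmem s).resolve_right fun h => hs ((ht' s).mp h.symm)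
  set U : Matrix n n ℝ := (hE.eigenvectorUnitary : Matrix n n ℝ) with hU
  refine ⟨fun i => U i t, ?_, fun i j => ?_⟩
  · have : (star U * U) t t = 1 := by
      rw [hU, Unitary.coe_star_mul_self]; simp
    simpa [Matrix.mul_apply, star_eq_conjTranspose] using this
  · conv_lhs => rw [hE.spectral_theorem, Unitary.conjStarAlgAut_apply]
    rw [← hU, Matrix.mul_apply, Finset.sum_eq_single t]
    · simp [Matrix.mul_apply, diagonal_apply, ← (ht' t).mpr rfl]
      ring
    · intro s _ hs
      simp [Matrix.mul_apply, diagonal_apply, hzero s hs]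
    · simp


open Polynomial Matrix Finset

/-! ### From the spectrum to a family of sets -/

/-- The bipartite incidence graph of a family of sets. -/
abbrev bipF {α β : Type} [Fintype α] [Fintype β] (r : α → Finset β) : FinGraph :=
  bip fun a b => b ∈ r a

/-- The condition on a family of sets that makes its incidence graph cospectral to a
subdivided star. -/
structure RowCond {α β : Type} [Fintype α] [DecidableEq β] (r : α → Finset β) : Prop where
  one_le : ∀ a, 1 ≤ #(r a)
  inter : ∀ a b, a ≠ b → #(r a ∩ r b) ^ 2 = (#(r a) - 1) * (#(r b) - 1)
  sum : ∑ a, #(r a) = 2 * Fintype.card α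

/-- The incidence matrix of a family of sets. -/
def incMat {α β : Type} [DecidableEq β] (r : α → Finset β) : Matrix α β ℝ :=
  Matrix.of fun a b => if b ∈ r a then 1 else 0

theorem incMat_mul_transpose {α β : Type} [Fintype β] [DecidableEq β] (r : α → Finset β)
    (a a' : α) : (incMat r * (incMat r)ᵀ) a a' = #(r a ∩ r a') := by
  simp only [incMat, Matrix.mul_apply, of_apply, transpose_apply, mul_ite, mul_one, mul_zero]
  rw [Finset.sum_ite_mem, Finset.univ_inter, Finset.sum_ite_mem, Finset.inter_comm]
  simp

section

variable {α β : Type} [Fintype α] [Fintype β] [DecidableEq α] [DecidableEq β]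

/-- With `w a = √(|r a| - 1)` the conditions say precisely that `N Nᵀ = 1 + w wᵀ` and that `w` has
squared norm `k`. -/
theorem RowCond.charpoly {r : α → Finset β} (h : RowCond r) :
    (incMat r * (incMat r)ᵀ).charpoly = (X ^ Fintype.card α -
      C (Fintype.card α : ℝ) * X ^ (Fintype.card α - 1)).comp (X - C 1) := by
  let w : α → ℝ := fun a => √(#(r a) - 1 : ℝ)
  have h1 (a) : (0 : ℝ) ≤ #(r a) - 1 := by
    have : (1 : ℝ) ≤ #(r a) := by exact_mod_cast h.one_le a
    linarith
  have hw : w ⬝ᵥ w = Fintype.card α := by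
    simp only [dotProduct, w, Real.mul_self_sqrt (h1 _), Finset.sum_sub_distrib]
    have : (∑ a, (#(r a) : ℝ)) = 2 * Fintype.card α := by exact_mod_cast h.sum
    rw [this]; simp; ring
  have hM : incMat r * (incMat r)ᵀ = 1 + vecMulVec w w := by
    ext a b
    rw [incMat_mul_transpose, Matrix.add_apply, vecMulVec_apply]
    by_cases hab : a = b
    · subst hab
      simp [w, Real.mul_self_sqrt (h1 _)]
    · rw [one_apply_ne hab, zero_add, ← Real.sqrt_mul (h1 a)]
      symm
      rw [Real.sqrt_eq_iff_mul_self_eq (mul_nonneg (h1 _) (h1 _)) (by positivity)]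
      have h2 := h.inter a b hab
      have h3 : ((#(r a ∩ r b) ^ 2 : ℕ) : ℝ) = ((#(r a) - 1 : ℕ) : ℝ) * ((#(r b) - 1 : ℕ) : ℝ) := by
        rw [h2]; push_cast; rfl
      rw [Nat.cast_sub (h.one_le a), Nat.cast_sub (h.one_le b)] at h3
      push_cast at h3
      linarith
  rw [hM, charpoly_one_add_vecMulVec, hw]

/-- Here `N Nᵀ - 1` has rank one with eigenvalue `k`, so it equals `k u uᵀ` for a unit vector `u`.
Its diagonal gives the row sizes, its other entries the intersections, and `|u| = 1` the sum. -/
theorem RowCond.of_charpoly {r : α → Finset β} (hk : 1 ≤ Fintype.card α)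
    (h : (incMat r * (incMat r)ᵀ).charpoly = (X ^ Fintype.card α -
      C (Fintype.card α : ℝ) * X ^ (Fintype.card α - 1)).comp (X - C 1)) : RowCond r := by
  have hH : (incMat r * (incMat r)ᵀ - scalar α (1 : ℝ)).IsHermitian := by
    refine IsHermitian.sub ?_ (by simp [IsHermitian])
    simpa using isHermitian_mul_conjTranspose_self (incMat r)
  have hc := charpoly_sub_scalar (incMat r * (incMat r)ᵀ) 1
  rw [h, comp_assoc] at hc
  simp only [sub_comp, X_comp, C_comp, add_sub_cancel_right, comp_X] at hc
  obtain ⟨u, hu, hE⟩ := exists_rank_one_of_charpoly hH (c := Fintype.card α)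
    (by exact_mod_cast hk) hk hc
  have hd (a) : (#(r a) : ℝ) = 1 + Fintype.card α * (u a * u a) := by
    have := hE a a
    rw [Matrix.sub_apply, incMat_mul_transpose, Finset.inter_self] at this
    simp at this
    linarith
  have ho (a b) (hab : a ≠ b) : (#(r a ∩ r b) : ℝ) = Fintype.card α * (u a * u b) := by
    have := hE a b
    rw [Matrix.sub_apply, incMat_mul_transpose] at this
    simpa [hab] using this
  have h1 (a) : 1 ≤ #(r a) := by
    have : (1 : ℝ) ≤ #(r a) := by
      rw [hd]; nlinarith [mul_nonneg (Nat.cast_nonneg (α := ℝ) (Fintype.card α)) (mul_self_nonneg (u a))]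
    exact_mod_cast this
  refine ⟨h1, fun a b hab => ?_, ?_⟩
  · rify
    rw [Nat.cast_sub (h1 a), Nat.cast_sub (h1 b), ho a b hab, hd, hd]
    push_cast; ring
  · rify
    simp only [hd, Finset.sum_add_distrib, ← Finset.mul_sum, hu]
    simp; ring

end

theorem spec_eq_iff (A B : FinGraph) [DecidableEq A.V] [DecidableRel A.graph.Adj]
    [DecidableEq B.V] [DecidableRel B.graph.Adj] :
    A.spec = B.spec ↔ (A.graph.adjMatrix ℝ).charpoly = (B.graph.adjMatrix ℝ).charpoly := by
  rw [← charpoly_eq_iff_roots_eq (by simp [IsHermitian]) (by simp [IsHermitian])]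
  unfold spec
  convert Iff.rfl

theorem charpoly_bipF {α β : Type} [Fintype α] [Fintype β] [DecidableEq α] [DecidableEq β]
    (r : α → Finset β) [DecidableEq (bipF r).V] [DecidableRel (bipF r).graph.Adj] :
    ((bipF r).graph.adjMatrix ℝ).charpoly * X ^ Fintype.card α =
      X ^ Fintype.card β * expand ℝ 2 (incMat r * (incMat r)ᵀ).charpoly := by
  classical
  have h : (bipGraph fun a b => b ∈ r a).adjMatrix ℝ =
      fromBlocks 0 (incMat r) (incMat r)ᵀ 0 := by
    ext (a | b) (a' | b') <;> simp [bipGraph_adj, bipAdj, incMat]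
  rw [← charpoly_fromBlocks_zero_mul, ← h]
  congr!

/-- Whether a graph is bipartite is determined by its spectrum. -/
theorem colorable_of_spec_eq {A B : FinGraph} (h : A.spec = B.spec) (hB : B.graph.Colorable 2) :
    A.graph.Colorable 2 := by
  classical
  rw [SimpleGraph.two_colorable_iff_forall_loop_even] at hB ⊢
  intro u w
  by_contra hw
  -- The trace of the `m`-th power counts closed walks of length `m` and is a power sum of
  -- eigenvalues. For odd `m` it vanishes on `B`, but the odd closed walk `w` makes it positive on
  -- `A`.
  have htr : ((A.graph.adjMatrix ℝ) ^ w.length).trace = ((B.graph.adjMatrix ℝ) ^ w.length).trace := by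
    rw [trace_pow_eq_sum_roots (by simp [IsHermitian]), trace_pow_eq_sum_roots (by simp [IsHermitian])]
    unfold spec at h
    rw [show (A.graph.adjMatrix ℝ).charpoly.roots = (B.graph.adjMatrix ℝ).charpoly.roots by
      convert h]
  have h0 : ((B.graph.adjMatrix ℝ) ^ w.length).trace = 0 := by
    refine Finset.sum_eq_zero fun v _ => ?_
    rw [diag_apply, SimpleGraph.adjMatrix_pow_apply_eq_card_walk, Nat.cast_eq_zero,
      Fintype.card_eq_zero_iff]
    exact ⟨fun p => hw (p.2 ▸ hB v p.1)⟩
  have h1 : 0 < ((A.graph.adjMatrix ℝ) ^ w.length).trace := by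
    refine Finset.sum_pos' (fun v _ => ?_) ⟨u, Finset.mem_univ _, ?_⟩
    · rw [diag_apply, SimpleGraph.adjMatrix_pow_apply_eq_card_walk]
      positivity
    · rw [diag_apply, SimpleGraph.adjMatrix_pow_apply_eq_card_walk, Nat.cast_pos,
        Fintype.card_pos_iff]
      exact ⟨⟨w, rfl⟩⟩
  linarith

theorem exists_iso_bipF {A : FinGraph} (h : A.graph.Colorable 2) :
    ∃ (α β : Type) (_ : Fintype α) (_ : Fintype β) (r : α → Finset β), A.Iso (bipF r) := by
  classical
  obtain ⟨c⟩ := h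
  refine ⟨{v // c v = 0}, {v // ¬ c v = 0}, inferInstance, inferInstance,
    fun a => {b | A.graph.Adj a b}, Iso.symm (Iso.of_equiv (H := A.graph)
      (Equiv.sumCompl fun v => c v = 0) ?_)⟩
  have h2 : ∀ i : Fin 2, i ≠ 0 → i = 1 := by decide
  rintro (a | b) (a' | b')
  · simp only [Equiv.sumCompl_apply_inl]
    exact iff_of_false (fun hadj => c.valid hadj (a.2.trans a'.2.symm)) id
  · simp [bipGraph_adj, bipAdj]
  · simp [bipGraph_adj, bipAdj, SimpleGraph.adj_comm]
  · simp only [Equiv.sumCompl_apply_inr]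
    exact iff_of_false (fun hadj => c.valid hadj ((h2 _ b.2).trans (h2 _ b'.2).symm)) id

theorem bip_colorable {α β : Type} [Fintype α] [Fintype β] (R : α → β → Prop) :
    (bip R).graph.Colorable 2 := by
  refine ⟨SimpleGraph.Coloring.mk (Sum.elim (fun _ => 0) fun _ => 1) ?_⟩
  rintro (a | b) (a' | b') h
  · exact h.elim
  · simp
  · simp
  · exact h.elim

theorem spec_bipF_eq {α β α' β' : Type} [Fintype α] [Fintype β] [DecidableEq β] [Fintype α']
    [Fintype β'] [DecidableEq β'] {r : α → Finset β} {r' : α' → Finset β'} (h : RowCond r)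
    (h' : RowCond r') (hα : Fintype.card α = Fintype.card α')
    (hβ : Fintype.card β = Fintype.card β') : (bipF r).spec = (bipF r').spec := by
  classical
  rw [spec_eq_iff]
  have h1 := h.charpoly
  rw [hα, ← h'.charpoly] at h1
  refine mul_right_cancel₀ (pow_ne_zero (Fintype.card α) (X_ne_zero (R := ℝ))) ?_
  rw [charpoly_bipF, h1, hα, charpoly_bipF, hβ]

/-- For the given family `N Nᵀ` is nonsingular, so the eigenvalue `0` of the graph has multiplicity
`|β| - |α| = 1`. Any bipartition of a cospectral graph has imbalance at most this multiplicity, and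
the odd order `2k + 1` then fixes both parts. -/
theorem RowCond.of_spec_eq {α β α' β' : Type} [Fintype α] [Fintype β] [DecidableEq β] [Fintype α']
    [Fintype β'] [DecidableEq β'] {r : α → Finset β} {r' : α' → Finset β'} (h : RowCond r)
    (hspec : (bipF r').spec = (bipF r).spec) (hk : 1 ≤ Fintype.card α)
    (hαβ : Fintype.card β = Fintype.card α + 1) (hle : Fintype.card α' ≤ Fintype.card β') :
    Fintype.card α' = Fintype.card α ∧ Fintype.card β' = Fintype.card β ∧ RowCond r' := by
  classical
  rw [spec_eq_iff] at hspec
  have hcard : Fintype.card α' + Fintype.card β' = 2 * Fintype.card α + 1 := by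
    have := congrArg natDegree hspec
    rw [charpoly_natDegree_eq_dim, charpoly_natDegree_eq_dim] at this
    have h1 : Fintype.card (α' ⊕ β') = Fintype.card (α ⊕ β) := this
    simp only [Fintype.card_sum] at h1
    omega
  have e1 := charpoly_bipF r
  have e2 := charpoly_bipF r'
  rw [hspec] at e2
  set q := (incMat r * (incMat r)ᵀ).charpoly with hq
  set q' := (incMat r' * (incMat r')ᵀ).charpoly with hq'
  have e3 : X ^ (Fintype.card β' + Fintype.card α) * expand ℝ 2 q' =
      X ^ (Fintype.card β + Fintype.card α') * expand ℝ 2 q := by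
    rw [pow_add, pow_add, mul_right_comm, ← e2, mul_right_comm _ _ (expand ℝ 2 q), ← e1]
    ring
  -- Up to sign the value is `k + 1`.
  have hq0 : q.eval 0 ≠ 0 := by
    rw [hq, h.charpoly]
    obtain ⟨k, hk'⟩ := Nat.exists_eq_add_of_le' hk
    rw [hk']
    simp only [eval_comp, eval_sub, eval_X, eval_C, eval_pow, eval_mul, zero_sub,
      Nat.add_sub_cancel]
    push_cast
    rw [pow_succ, ← mul_comm ((-1 : ℝ) ^ k), ← mul_sub]
    refine mul_ne_zero (pow_ne_zero _ (by norm_num)) ?_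
    have : (0 : ℝ) ≤ k := Nat.cast_nonneg k
    linarith
  -- Otherwise `e3`, after cancelling powers of `X`, would make `X` divide `q(X²)`.
  have hβle : Fintype.card β' + Fintype.card α ≤ Fintype.card β + Fintype.card α' := by
    by_contra hlt
    obtain ⟨d, hd⟩ := Nat.exists_eq_add_of_lt (not_le.mp hlt)
    rw [hd, add_assoc, pow_add, mul_assoc] at e3
    have e4 := mul_left_cancel₀ (pow_ne_zero _ (X_ne_zero (R := ℝ))) e3
    have e5 := congrArg (eval 0) e4
    rw [eval_mul, expand_eval, expand_eval] at e5
    simp at e5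
    exact hq0 e5.symm
  have hα : Fintype.card α' = Fintype.card α := by omega
  have hβ : Fintype.card β' = Fintype.card β := by omega
  refine ⟨hα, hβ, RowCond.of_charpoly (by omega) ?_⟩
  rw [hα, hβ] at e3
  have e4 := mul_left_cancel₀ (pow_ne_zero _ (X_ne_zero (R := ℝ))) e3
  rw [← hq', expand_injective (by norm_num) e4, hα, hq, h.charpoly]

/-- The family of sets whose incidence graph is the subdivided star. -/
def starRows (k : ℕ) (i : Fin k) : Finset (Option (Fin k)) := {some i, none}

theorem graphS_iso_bipF (k : ℕ) : (graphS k).Iso (bipF (starRows k)) := by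
  refine (graphS_iso_bip k).trans (bip_iso_of_equiv (Equiv.refl _) (Equiv.refl _) ?_)
  simp [starRows]

theorem rowCond_starRows (k : ℕ) : RowCond (starRows k) where
  one_le a := by simp [starRows]
  inter a b hab := by
    have : starRows k a ∩ starRows k b = {none} := by
      ext (_ | c)
      · simp [starRows]
      · simp only [starRows, mem_inter, mem_insert, mem_singleton, Option.some.injEq]
        constructor
        · rintro ⟨h1 | h1, h2 | h2⟩
          · exact absurd (h1.symm.trans h2) hab
          all_goals simp_all
        · simp
    rw [this]
    simp [starRows]
  sum := by simp [starRows, mul_comm]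

/-- A graph is cospectral to the subdivided star if and only if it is the incidence graph of a
family of sets that satisfies `RowCond`. -/
theorem spec_eq_graphS_iff {k : ℕ} (hk : 1 ≤ k) (B : FinGraph) :
    B.spec = (graphS k).spec ↔ ∃ (α β : Type) (_ : Fintype α) (_ : Fintype β) (_ : DecidableEq β)
      (r : α → Finset β), Fintype.card α = k ∧ Fintype.card β = k + 1 ∧ RowCond r ∧
        B.Iso (bipF r) := by
  classical
  have hS := spec_eq_of_iso (graphS_iso_bipF k)
  constructor
  · intro h
    have hcol : B.graph.Colorable 2 := by
      refine colorable_of_spec_eq (h.trans hS) (bip_colorable _)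
    obtain ⟨α, β, _, _, r, hr⟩ := exists_iso_bipF hcol
    -- The smaller part has to index the rows; otherwise the family of columns is used.
    wlog hle : Fintype.card α ≤ Fintype.card β generalizing α β
    · refine this β α _ _ (fun b => Finset.univ.filter fun a => b ∈ r a) ?_ (by omega)
      refine (hr.trans (bip_iso_swap _)).trans
        (bip_iso_of_equiv (Equiv.refl _) (Equiv.refl _) fun a b =>
          Finset.mem_filter.trans (and_iff_right (Finset.mem_univ _)))
    obtain ⟨h1, h2, h3⟩ := (rowCond_starRows k).of_spec_eq (r' := r)
      ((spec_eq_of_iso hr).symm.trans (h.trans hS)) (by simpa using hk) (by simp) hle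
    exact ⟨α, β, _, _, _, r, by simpa using h1, by simpa using h2, h3, hr⟩
  · rintro ⟨α, β, _, _, _, r, h1, h2, h3, hr⟩
    rw [hS, spec_eq_of_iso hr]
    exact spec_bipF_eq h3 (rowCond_starRows k) (by simpa using h1) (by simpa using h2)


open Finset

/-! ### Families of sets that pairwise meet in all but one element -/

/-- Here `x`, `y` are row sizes minus one and `c` is the size of the intersection. If `x < y`, then
`x < c ≤ x + 1`, and `(x + 1)² = x y` becomes `x (y - x - 2) = 1`. -/
theorem eq_or_one_four_of_mul_eq_sq {x y c : ℕ} (hx : 1 ≤ x) (hy : 1 ≤ y) (hcx : c ≤ x + 1)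
    (hcy : c ≤ y + 1) (h : c ^ 2 = x * y) : x = y ∨ (x = 1 ∧ y = 4) ∨ (x = 4 ∧ y = 1) := by
  have key : ∀ u v : ℕ, 1 ≤ u → u < v → c ≤ u + 1 → c ^ 2 = u * v → u = 1 ∧ v = 4 := by
    intro u v hu huv hc hcuv
    have h1 : u < c := by
      by_contra hle
      nlinarith [not_lt.mp hle]
    have h2 : c = u + 1 := by omega
    subst h2
    obtain ⟨w, rfl⟩ := Nat.exists_eq_add_of_lt huv
    have h3 : u * (w - 1) = 1 := by
      rcases w with _ | w
      · exfalso; nlinarith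
      · rw [Nat.add_sub_cancel]; nlinarith
    have h4 := Nat.eq_one_of_mul_eq_one_left h3
    have h5 := Nat.eq_one_of_mul_eq_one_right h3
    omega
  rcases lt_trichotomy x y with h1 | h1 | h1
  · exact Or.inr (Or.inl (key x y hx h1 hcx h))
  · exact Or.inl h1
  · exact Or.inr (Or.inr (key y x hy h1 hcy (by rw [h, mul_comm])).symm)

section

variable {ι β : Type} [DecidableEq β]

/-- Fix two rows `A`, `B`. If every row contains `A ∩ B`, that is the kernel. Otherwise some row `c`
does not, and then all rows lie in `A ∪ B`. The set `W` matters only when there is a single row: its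
kernel is not determined and can be chosen to contain `W`. -/
theorem sunflower_or_subset {P : Finset ι} {r : ι → Finset β} {n : ℕ}
    (hcard : ∀ a ∈ P, #(r a) = n + 1)
    (hint : ∀ a ∈ P, ∀ b ∈ P, a ≠ b → #(r a ∩ r b) = n) (hP : P.Nonempty) {W : Finset β}
    (hW : ∀ a ∈ P, W ⊆ r a) (hWn : #W ≤ n) :
    (∃ C, W ⊆ C ∧ #C = n ∧ ∀ a ∈ P, C ⊆ r a) ∨
      (∃ U, #U = n + 2 ∧ 3 ≤ #P ∧ ∀ a ∈ P, r a ⊆ U) := by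
  by_cases h1 : ∀ a ∈ P, ∀ b ∈ P, a = b
  · obtain ⟨a, ha⟩ := hP
    obtain ⟨C, hWC, hCa, hC⟩ := exists_subsuperset_card_eq (hW a ha) hWn
      (by rw [hcard a ha]; omega)
    exact Or.inl ⟨C, hWC, hC, fun b hb => h1 a ha b hb ▸ hCa⟩
  push Not at h1
  obtain ⟨a, ha, b, hb, hab⟩ := h1
  by_cases h2 : ∀ c ∈ P, r a ∩ r b ⊆ r c
  · exact Or.inl ⟨r a ∩ r b, subset_inter (hW a ha) (hW b hb), hint a ha b hb hab, h2⟩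
  have hU : #(r a ∪ r b) = n + 2 := by
    have := card_union_add_card_inter (r a) (r b)
    rw [hcard a ha, hcard b hb, hint a ha b hb hab] at this
    omega
  have key : ∀ c ∈ P, ¬ r a ∩ r b ⊆ r c → r c ⊆ r a ∪ r b := by
    intro c hc hcab
    have hca : c ≠ a := by rintro rfl; exact hcab inter_subset_left
    have hcb : c ≠ b := by rintro rfl; exact hcab inter_subset_right
    -- Inclusion-exclusion inside `r c`: its traces on `A` and `B` have `n` points each and share
    -- fewer than `n`, so together they fill the `n + 1` points of `r c`.
    have e1 := card_union_add_card_inter (r c ∩ r a) (r c ∩ r b)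
    rw [hint c hc a ha hca, hint c hc b hb hcb, ← inter_union_distrib_left,
      ← inter_inter_distrib_left] at e1
    have e2 : #(r c ∩ (r a ∩ r b)) < n := by
      rw [← hint a ha b hb hab]
      exact card_lt_card (Finset.ssubset_iff_subset_ne.mpr ⟨inter_subset_right, fun h => hcab
        (inter_eq_right.mp h)⟩)
    have e3 : r c ∩ (r a ∪ r b) = r c :=
      eq_of_subset_of_card_le inter_subset_left (by rw [hcard c hc]; omega)
    exact inter_eq_left.mp e3
  push Not at h2
  obtain ⟨c, hc, hcab⟩ := h2
  have hca : c ≠ a := by rintro rfl; exact hcab inter_subset_left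
  have hcb : c ≠ b := by rintro rfl; exact hcab inter_subset_right
  refine Or.inr ⟨r a ∪ r b, hU, ?_, fun x hx => ?_⟩
  · classical
    rw [← card_eq_three.mpr ⟨a, b, c, hab, hca.symm, hcb.symm, rfl⟩]
    refine card_le_card ?_
    simp [insert_subset_iff, ha, hb, hc]
  · by_cases hxab : r a ∩ r b ⊆ r x
    · by_cases hxc : x = c
      · exact absurd (hxc ▸ hxab) hcab
      have e1 : #(r x \ (r a ∩ r b)) = 1 := by
        rw [card_sdiff_of_subset hxab, hcard x hx, hint a ha b hb hab]; omega
      obtain ⟨y, hy⟩ := card_eq_one.mp e1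
      intro v hv
      by_cases hvab : v ∈ r a ∩ r b
      · exact mem_union_left _ (mem_inter.mp hvab).1
      have hvy : v = y := mem_singleton.mp (hy ▸ mem_sdiff.mpr ⟨hv, hvab⟩)
      by_contra hvU
      -- The row `r x` is `A ∩ B` with one more point `y`. If `y` is outside `A ∪ B`, it is not in
      -- `r c`, and then `r x` meets `r c` in fewer than `n` points.
      have hsub : r x ∩ r c ⊆ r c ∩ (r a ∩ r b) := by
        intro w hw
        rw [mem_inter] at hw
        refine mem_inter.mpr ⟨hw.2, ?_⟩
        by_contra hwab
        have hwy : w = y := mem_singleton.mp (hy ▸ mem_sdiff.mpr ⟨hw.1, hwab⟩)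
        exact hvU (key c hc hcab (hvy.trans hwy.symm ▸ hw.2))
      have e2 : #(r c ∩ (r a ∩ r b)) < n := by
        rw [← hint a ha b hb hab]
        exact card_lt_card (Finset.ssubset_iff_subset_ne.mpr ⟨inter_subset_right, fun h => hcab
          (inter_eq_right.mp h)⟩)
      have e3 := card_le_card hsub
      rw [hint x hx c hc hxc] at e3
      omega
    · exact key x hx hxab

/-- A family of `(n+1)`-sets that pairwise meet in `n` elements either is a sunflower or consists
of subsets of a set with `n + 2` elements. -/
theorem sunflower_or_clique {P : Finset ι} {r : ι → Finset β} {n : ℕ}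
    (hcard : ∀ a ∈ P, #(r a) = n + 1)
    (hint : ∀ a ∈ P, ∀ b ∈ P, a ≠ b → #(r a ∩ r b) = n) (hP : P.Nonempty) {W : Finset β}
    (hW : ∀ a ∈ P, W ⊆ r a) (hWn : #W ≤ n) :
    (∃ (C : Finset β) (f : ι → β), W ⊆ C ∧ #C = n ∧ (∀ a ∈ P, f a ∉ C ∧ r a = insert (f a) C) ∧
      Set.InjOn f P) ∨
    (∃ (U : Finset β) (f : ι → β), #U = n + 2 ∧ 3 ≤ #P ∧
      (∀ a ∈ P, f a ∈ U ∧ r a = U.erase (f a)) ∧ Set.InjOn f P) := by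
  have hβ : Nonempty β := by
    obtain ⟨a, ha⟩ := hP
    have : 0 < #(r a) := by rw [hcard a ha]; omega
    exact (card_pos.mp this).to_type
  have hne : ∀ a ∈ P, ∀ b ∈ P, r a = r b → a = b := by
    intro a ha b hb h
    by_contra hab
    have := hint a ha b hb hab
    rw [← h, inter_self, hcard a ha] at this
    omega
  rcases sunflower_or_subset hcard hint hP hW hWn with ⟨C, hWC, hC, hCr⟩ | ⟨U, hU, h3, hUr⟩
  · have : ∀ a, ∃ y, a ∈ P → y ∉ C ∧ r a = insert y C := by
      intro a
      by_cases ha : a ∈ P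
      · have e1 : #(r a \ C) = 1 := by
          rw [card_sdiff_of_subset (hCr a ha), hcard a ha, hC]; omega
        obtain ⟨y, hy⟩ := card_eq_one.mp e1
        have hy' : y ∈ r a \ C := hy ▸ mem_singleton_self y
        refine ⟨y, fun _ => ⟨(mem_sdiff.mp hy').2, ?_⟩⟩
        rw [← sdiff_union_of_subset (hCr a ha), hy, insert_eq]
      · exact ⟨hβ.some, fun h => absurd h ha⟩
    choose f hf using this
    refine Or.inl ⟨C, f, hWC, hC, hf, fun a ha b hb h => hne a ha b hb ?_⟩
    rw [(hf a ha).2, (hf b hb).2, h]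
  · have : ∀ a, ∃ y, a ∈ P → y ∈ U ∧ r a = U.erase y := by
      intro a
      by_cases ha : a ∈ P
      · have e1 : #(U \ r a) = 1 := by
          rw [card_sdiff_of_subset (hUr a ha), hcard a ha, hU]; omega
        obtain ⟨y, hy⟩ := card_eq_one.mp e1
        have hy' : y ∈ U \ r a := hy ▸ mem_singleton_self y
        refine ⟨y, fun _ => ⟨(mem_sdiff.mp hy').1, ?_⟩⟩
        rw [← sdiff_singleton_eq_erase, ← hy, Finset.sdiff_sdiff_eq_self (hUr a ha)]
      · exact ⟨hβ.some, fun h => absurd h ha⟩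
    choose f hf using this
    refine Or.inr ⟨U, f, hU, h3, hf, fun a ha b hb h => hne a ha b hb ?_⟩
    rw [(hf a ha).2, (hf b hb).2, h]

theorem exists_mem_of_clique {r : ι → Finset β} {P : Finset ι} {U : Finset β} {f : ι → β} (hP : 3 ≤ #P)
    (hr : ∀ a ∈ P, f a ∈ U ∧ r a = U.erase (f a)) (hf : Set.InjOn f P) {y : β} (hy : y ∈ U) :
    ∃ a ∈ P, y ∈ r a := by
  obtain ⟨a, ha, b, hb, hab⟩ := one_lt_card.mp (show 1 < #P by omega)
  by_cases hya : y = f a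
  · refine ⟨b, hb, ?_⟩
    rw [(hr b hb).2, mem_erase]
    exact ⟨fun h => hab (hf ha hb (hya ▸ h)), hy⟩
  · refine ⟨a, ha, ?_⟩
    rw [(hr a ha).2, mem_erase]
    exact ⟨hya, hy⟩

end

/-! ### Standard families -/

section

variable {α : Type} [Fintype α]

open Classical in
/-- The standard families of sets. The index set is split by `τ` in three kinds: rows of kind `0`
are singletons, rows of kind `1` form a star (if `p`) or the complements of the points of
a set, and a row of kind `2` contains all points of kind `1`, the point `none` if `s` holds, and
either its own point (if `o`) or all other points of kind `2`. -/
noncomputable def stdRows (p o s : Bool) (τ : α → Fin 3) (a : α) : Finset (Option α) :=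
  univ.filter fun c => match c with
    | none => (τ a = 1 ∧ p = true) ∨ (τ a = 2 ∧ s = true)
    | some b => (τ a = 0 ∧ b = a) ∨
        (τ a = 1 ∧ ((p = true ∧ b = a) ∨ (p = false ∧ τ b = 1 ∧ b ≠ a))) ∨
        (τ a = 2 ∧ (τ b = 1 ∨ (o = true ∧ b = a) ∨ (o = false ∧ τ b = 2 ∧ b ≠ a)))

theorem none_mem_stdRows {p o s : Bool} {τ : α → Fin 3} {a : α} :
    none ∈ stdRows p o s τ a ↔ (τ a = 1 ∧ p = true) ∨ (τ a = 2 ∧ s = true) := by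
  simp [stdRows]

theorem some_mem_stdRows {p o s : Bool} {τ : α → Fin 3} {a b : α} :
    some b ∈ stdRows p o s τ a ↔ (τ a = 0 ∧ b = a) ∨
        (τ a = 1 ∧ ((p = true ∧ b = a) ∨ (p = false ∧ τ b = 1 ∧ b ≠ a))) ∨
        (τ a = 2 ∧ (τ b = 1 ∨ (o = true ∧ b = a) ∨ (o = false ∧ τ b = 2 ∧ b ≠ a))) := by
  simp [stdRows]

end

/-- The parameters of the standard families that satisfy `RowCond`. -/
inductive StdParam : Bool → Bool → Bool → ℕ → ℕ → ℕ → Prop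
  | star (k : ℕ) : StdParam true true true k 0 k
  | L (n : ℕ) : 1 ≤ n → StdParam true false false 0 (n + 2) (n * (n + 2))
  | H (n : ℕ) : 2 ≤ n → StdParam true false true 0 (n + 1) (n * (n + 1))
  | R (d : ℕ) : 1 ≤ d → StdParam true true true 3 d (4 * d + 3)
  | Q (d : ℕ) : 1 ≤ d → StdParam false true true 3 d (4 * d + 3)
  | G1 : StdParam true false true 4 1 8
  | G2 : StdParam false false false 3 3 15
  | G3 : StdParam true false true 1 4 17
  | G4 : StdParam true false true 2 3 14


open Finset

/-! ### Classification of the families of sets that satisfy `RowCond` -/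

section

variable {α β : Type} [Fintype α] [DecidableEq β] {r : α → Finset β}

/-- A singleton row makes the product in `RowCond.inter` zero. Such rows are therefore the `K₂`
components. -/
theorem RowCond.not_mem_of_card_eq_one (h : RowCond r) {z b : α} (hz : #(r z) = 1) (hb : z ≠ b)
    {y : β} (hy : y ∈ r b) : y ∉ r z := by
  intro hyz
  have := h.inter z b hb
  rw [hz] at this
  simp only [le_refl, tsub_eq_zero_of_le, zero_mul, ne_eq, OfNat.ofNat_ne_zero, not_false_eq_true,
    pow_eq_zero_iff, card_eq_zero] at this
  exact notMem_empty y (this ▸ mem_inter.mpr ⟨hyz, hy⟩)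

variable [Fintype β]

/-- The singleton rows occupy distinct points outside `V`. When `|β| = |α| + 1`, this bounds the
number of points covered by the other rows by their number plus one, which drives every case
distinction below. -/
theorem RowCond.card_add_card_le (h : RowCond r) (V : Finset β) {Z : Finset α}
    (hZ : ∀ z ∈ Z, #(r z) = 1) (hV : ∀ y ∈ V, ∀ z ∈ Z, y ∉ r z) : #V + #Z ≤ Fintype.card β := by
  have h1 : #(Z.biUnion r) = #Z := by
    rw [card_biUnion, sum_congr rfl hZ]
    · simp
    · intro z hz z' _ hzz
      exact disjoint_left.mpr fun y hy hy' => h.not_mem_of_card_eq_one (hZ z hz) hzz hy' hy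
  rw [← h1, ← card_union_of_disjoint]
  · exact card_le_univ _
  · refine disjoint_left.mpr fun y hy hy' => ?_
    obtain ⟨z, hz, hyz⟩ := mem_biUnion.mp hy'
    exact hV y hy z hz hyz

/-- A family that satisfies `RowCond` has standard form if suitable representatives of its rows
are given. -/
theorem RowCond.exists_equiv_stdRows (h : RowCond r) (hβ : Fintype.card β = Fintype.card α + 1)
    (p o s : Bool) (τ : α → Fin 3) (g : α → β) (x : β)
    (hz : ∀ a, τ a = 0 → #(r a) = 1)
    (hg : ∀ a b, τ a ≠ 0 → τ b ≠ 0 → g a = g b → a = b)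
    (hgz : ∀ a z, τ a ≠ 0 → τ z = 0 → g a ∉ r z)
    (hx : ∀ a, τ a ≠ 0 → x ≠ g a) (hxz : ∀ z, τ z = 0 → x ∉ r z)
    (h1 : ∀ a, τ a = 1 → ∀ y, y ∈ r a ↔ (p = true ∧ (y = g a ∨ y = x)) ∨
      (p = false ∧ y ≠ g a ∧ ∃ b, τ b = 1 ∧ y = g b))
    (h2 : ∀ a, τ a = 2 → ∀ y, y ∈ r a ↔ (s = true ∧ y = x) ∨ (∃ b, τ b = 1 ∧ y = g b) ∨
      (o = true ∧ y = g a) ∨ (o = false ∧ y ≠ g a ∧ ∃ b, τ b = 2 ∧ y = g b)) :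
    ∃ e : Option α ≃ β, ∀ a c, e c ∈ r a ↔ c ∈ stdRows p o s τ a := by
  -- The representative of a singleton row is its only point; the value `x` elsewhere is a dummy.
  have hfz : ∀ a, ∃ y, τ a = 0 → r a = {y} := fun a => by
    by_cases ha : τ a = 0
    · obtain ⟨y, hy⟩ := card_eq_one.mp (hz a ha)
      exact ⟨y, fun _ => hy⟩
    · exact ⟨x, fun h => absurd h ha⟩
  choose fz hfz using hfz
  let f : α → β := fun a => if τ a = 0 then fz a else g a
  have f0 : ∀ a, τ a = 0 → r a = {f a} := fun a ha => by simp [f, ha, hfz a ha]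
  have fg : ∀ a, τ a ≠ 0 → f a = g a := fun a ha => by simp [f, ha]
  have hf : Function.Injective f := by
    intro a b hab
    by_cases ha : τ a = 0 <;> by_cases hb : τ b = 0
    · by_contra hne
      refine h.not_mem_of_card_eq_one (hz a ha) hne (y := f b) ?_ ?_
      · rw [f0 b hb]; simp
      · rw [f0 a ha]; simp [hab]
    · refine absurd ?_ (hgz b a hb ha)
      rw [f0 a ha, mem_singleton, hab, fg b hb]
    · refine absurd ?_ (hgz a b ha hb)
      rw [f0 b hb, mem_singleton, ← hab, fg a ha]
    · exact hg a b ha hb (by rw [← fg a ha, ← fg b hb, hab])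
  have hxf : ∀ a, x ≠ f a := by
    intro a
    by_cases ha : τ a = 0
    · have := hxz a ha
      rw [f0 a ha] at this
      simpa using this
    · rw [fg a ha]; exact hx a ha
  -- Each row gets its own point and `none` becomes `x`. These points are distinct, and their number
  -- is `|α| + 1 = |β|`.
  let e : Option α ≃ β := Equiv.ofBijective (fun c => c.elim x f) (by
    rw [Fintype.bijective_iff_injective_and_card]
    refine ⟨?_, by simp [hβ]⟩
    rintro (_ | a) (_ | b) hab
    · rfl
    · exact absurd hab (hxf b)
    · exact absurd hab.symm (hxf a)
    · exact congrArg some (hf hab))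
  have en : e none = x := rfl
  have es : ∀ a, e (some a) = f a := fun _ => rfl
  have hτ : ∀ a, τ a = 0 ∨ τ a = 1 ∨ τ a = 2 := fun a => by
    generalize τ a = i; fin_cases i <;> simp
  have hT : ∀ y, (∃ b, τ b = 1 ∧ y = g b) ↔ ∃ b, τ b = 1 ∧ y = f b := fun y =>
    exists_congr fun b => and_congr_right fun hb => by rw [fg b (by simp [hb])]
  have hD : ∀ y, (∃ b, τ b = 2 ∧ y = g b) ↔ ∃ b, τ b = 2 ∧ y = f b := fun y =>
    exists_congr fun b => and_congr_right fun hb => by rw [fg b (by simp [hb])]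
  refine ⟨e, fun a c => ?_⟩
  rcases hτ a with ha | ha | ha
  · rw [f0 a ha, mem_singleton]
    rcases c with _ | b
    · simp [none_mem_stdRows, en, ha, hxf]
    · simp [some_mem_stdRows, es, ha, hf.eq_iff]
  · rw [h1 a ha, hT, ← fg a (by simp [ha])]
    rcases c with _ | b
    · simp [none_mem_stdRows, en, ha, hxf]
    · simp [some_mem_stdRows, es, ha, hf.eq_iff, (hxf _).symm, and_comm]
  · rw [h2 a ha, hT, hD, ← fg a (by simp [ha])]
    rcases c with _ | b
    · simp [none_mem_stdRows, en, ha, hxf]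
    · simp [some_mem_stdRows, es, ha, hf.eq_iff, (hxf _).symm, and_comm]

/-- There is a point outside of all representatives. -/
theorem exists_not_mem_rows (r : α → Finset β) (hβ : Fintype.card β = Fintype.card α + 1)
    (τ : α → Fin 3) (g : α → β) (hz : ∀ a, τ a = 0 → #(r a) = 1) :
    ∃ x, (∀ a, τ a ≠ 0 → x ≠ g a) ∧ ∀ z, τ z = 0 → x ∉ r z := by
  classical
  let Z : Finset α := {a | τ a = 0}
  let V : Finset β := ({a | τ a ≠ 0} : Finset α).image g ∪ Z.biUnion r
  have hV : #V < Fintype.card β := by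
    have e1 : #(Z.biUnion r) ≤ #Z := by
      refine card_biUnion_le.trans ?_
      rw [sum_congr rfl fun a ha => hz a (by simpa [Z] using ha)]
      simp
    have e2 : #(({a | τ a ≠ 0} : Finset α).image g) ≤ #({a | τ a ≠ 0} : Finset α) := card_image_le
    have e3 := card_union_le (({a | τ a ≠ 0} : Finset α).image g) (Z.biUnion r)
    have e4 := card_filter_add_card_filter_not (s := (univ : Finset α)) (fun a => τ a = 0)
    rw [card_univ] at e4
    simp only [V, Z, ne_eq] at *
    omega
  obtain ⟨x, hx⟩ : ∃ x, x ∉ V := by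
    by_contra hall
    push Not at hall
    rw [eq_univ_of_forall hall, card_univ] at hV
    exact hV.false
  simp only [V, Z, mem_union, mem_image, mem_filter, mem_univ, true_and, mem_biUnion, not_or,
    not_exists, not_and] at hx
  exact ⟨x, fun a ha hxa => hx.1 a ha hxa.symm, hx.2⟩

end


/-! ### Possible row sizes and the uniform case -/

open Finset

section

variable {α β : Type} [Fintype α] [DecidableEq β] {r : α → Finset β}

theorem RowCond.card_inter (h : RowCond r) {n : ℕ} {a b : α} (hab : a ≠ b) (ha : #(r a) = n + 1)
    (hb : #(r b) = n + 1) : #(r a ∩ r b) = n := by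
  have := h.inter a b hab
  rw [ha, hb, Nat.add_sub_cancel, ← sq] at this
  exact Nat.pow_left_injective two_ne_zero this

theorem RowCond.subset_of_card (h : RowCond r) {a b : α} (ha : #(r a) = 2) (hb : #(r b) = 5) :
    r a ⊆ r b := by
  have hab : a ≠ b := by rintro rfl; omega
  have h1 := h.inter a b hab
  rw [ha, hb] at h1
  have h2 : #(r a ∩ r b) = 2 := Nat.pow_left_injective two_ne_zero h1
  exact inter_eq_left.mp (eq_of_subset_of_card_le inter_subset_left (by omega))

theorem RowCond.uniform_or_two_five (h : RowCond r) (hα : 1 ≤ Fintype.card α) :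
    (∃ n, 1 ≤ n ∧ ∀ a, #(r a) = 1 ∨ #(r a) = n + 1) ∨
      ((∃ a, #(r a) = 2) ∧ (∃ a, #(r a) = 5) ∧ ∀ a, #(r a) = 1 ∨ #(r a) = 2 ∨ #(r a) = 5) := by
  have pair : ∀ a b, #(r a) ≠ 1 → #(r b) ≠ 1 → #(r a) = #(r b) ∨ (#(r a) = 2 ∧ #(r b) = 5) ∨
      (#(r a) = 5 ∧ #(r b) = 2) := by
    intro a b ha hb
    by_cases hab : a = b
    · exact Or.inl (by rw [hab])
    have h1 := h.one_le a
    have h2 := h.one_le b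
    have h3 := card_le_card (inter_subset_left : r a ∩ r b ⊆ r a)
    have h4 := card_le_card (inter_subset_right : r a ∩ r b ⊆ r b)
    have := eq_or_one_four_of_mul_eq_sq (x := #(r a) - 1) (y := #(r b) - 1) (by omega) (by omega)
      (by omega) (by omega) (h.inter a b hab)
    omega
  -- The row sizes have average `2`, so they are not all `1`.
  obtain ⟨a, ha⟩ : ∃ a, #(r a) ≠ 1 := by
    by_contra hall
    push Not at hall
    have := h.sum
    simp only [hall, sum_const, card_univ, smul_eq_mul, mul_one] at this
    omega
  have h1 := h.one_le a
  by_cases hall : ∀ b, #(r b) = 1 ∨ #(r b) = #(r a)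
  · exact Or.inl ⟨#(r a) - 1, by omega, fun b => by have := hall b; omega⟩
  · push Not at hall
    obtain ⟨b, hb, hba⟩ := hall
    have hab := pair a b ha hb
    refine Or.inr ⟨?_, ?_, fun c => ?_⟩
    · rcases hab with h2 | h2 | h2
      · exact absurd h2.symm hba
      · exact ⟨a, h2.1⟩
      · exact ⟨b, h2.2⟩
    · rcases hab with h2 | h2 | h2
      · exact absurd h2.symm hba
      · exact ⟨b, h2.2⟩
      · exact ⟨a, h2.1⟩
    · by_cases hc : #(r c) = 1
      · exact Or.inl hc
      · have := pair a c ha hc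
        have := pair b c hb hc
        omega

variable [Fintype β]

/-- The conclusion of the classification: up to a renaming of the points the family is standard
with admissible parameters. -/
def IsStandard (r : α → Finset β) : Prop :=
  ∃ (p o s : Bool) (τ : α → Fin 3) (e : Option α ≃ β),
    StdParam p o s #{a | τ a = 1} #{a | τ a = 2} (Fintype.card α) ∧
      ∀ a c, e c ∈ r a ↔ c ∈ stdRows p o s τ a

/-- Let `P` be the set of rows that are not singletons; the sum condition reads `#P * n = k`. A
sunflower covers `n + #P` points, at most `#P + 1`, so `n = 1` and the graph is the star. Otherwise
`n + 2` points are covered and `n + 2 ≤ #P + 1`, while the omitted points are distinct, so `#P ≤ n +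
2`. The two values left give `L` and `H`. -/
theorem RowCond.isStandard_of_uniform (h : RowCond r) (hα : 1 ≤ Fintype.card α)
    (hβ : Fintype.card β = Fintype.card α + 1) {n : ℕ} (hn : 1 ≤ n)
    (hr : ∀ a, #(r a) = 1 ∨ #(r a) = n + 1) : IsStandard r := by
  classical
  let P : Finset α := {a | #(r a) ≠ 1}
  let Z : Finset α := {a | #(r a) = 1}
  have hP : ∀ a, a ∈ P ↔ #(r a) ≠ 1 := by simp [P]
  have hZ : ∀ a ∈ Z, #(r a) = 1 := by simp [Z]
  have hPn : ∀ a ∈ P, #(r a) = n + 1 := fun a ha => (hr a).resolve_left ((hP a).mp ha)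
  have hPZ : #Z + #P = Fintype.card α := card_filter_add_card_filter_not _
  have hsum : #P * n = Fintype.card α := by
    have h1 := h.sum
    rw [← sum_filter_add_sum_filter_not univ (fun a => #(r a) = 1),
      sum_congr rfl hZ, sum_congr rfl hPn] at h1
    simp only [sum_const, smul_eq_mul, mul_one] at h1
    change #Z + #P * (n + 1) = _ at h1
    rw [mul_add] at h1
    omega
  have hPne : P.Nonempty := by
    rw [← card_pos]
    by_contra h0
    rw [not_lt, Nat.le_zero] at h0
    rw [h0] at hsum
    omega
  have hnotZ : ∀ a ∈ P, ∀ y ∈ r a, ∀ z ∈ Z, y ∉ r z := by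
    intro a ha y hy z hz
    refine h.not_mem_of_card_eq_one (hZ z hz) ?_ hy
    rintro rfl
    exact (hP _).mp ha (hZ _ hz)
  rcases sunflower_or_clique hPn (fun a ha b hb hab => h.card_inter hab (hPn a ha) (hPn b hb))
    hPne (W := ∅) (by simp) (by simp) with ⟨C, f, -, hC, hf, hinj⟩ | ⟨U, f, hU, h3, hf, hinj⟩
  · have hV : #(C ∪ P.image f) = n + #P := by
      rw [card_union_of_disjoint, hC, card_image_of_injOn hinj]
      refine disjoint_left.mpr fun y hy hy' => ?_
      obtain ⟨a, ha, rfl⟩ := mem_image.mp hy'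
      exact (hf a ha).1 hy
    have hle := h.card_add_card_le (C ∪ P.image f) hZ (by
      intro y hy
      rcases mem_union.mp hy with hy | hy
      · obtain ⟨a, ha⟩ := hPne
        exact hnotZ a ha y ((hf a ha).2 ▸ mem_insert_of_mem hy)
      · obtain ⟨a, ha, rfl⟩ := mem_image.mp hy
        exact hnotZ a ha _ ((hf a ha).2 ▸ mem_insert_self _ _))
    obtain rfl : n = 1 := by omega
    obtain ⟨x, rfl⟩ := card_eq_one.mp hC
    have hPu : P = univ := by
      rw [← card_eq_iff_eq_univ]; omega
    have hall : ∀ a, a ∈ P := fun a => hPu ▸ mem_univ a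
    obtain ⟨e, he⟩ := h.exists_equiv_stdRows hβ true true true (fun _ => 1) f x (by simp)
      (fun a b _ _ hab => hinj (hall a) (hall b) hab) (by simp)
      (fun a _ hxa => (hf a (hall a)).1 (by simp [hxa])) (by simp)
      (fun a _ y => by rw [(hf a (hall a)).2]; simp) (by simp)
    refine ⟨true, true, true, _, e, ?_, he⟩
    simpa using StdParam.star _
  · have hle := h.card_add_card_le U hZ (by
      intro y hy
      obtain ⟨a, ha, hya⟩ := exists_mem_of_clique h3 hf hinj hy
      exact hnotZ a ha y hya)
    have hsub : P.image f ⊆ U := image_subset_iff.mpr fun a ha => (hf a ha).1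
    have hcard : #(P.image f) = #P := card_image_of_injOn hinj
    have hle' := card_le_card hsub
    let τ : α → Fin 3 := fun a => if a ∈ P then 2 else 0
    have hτ0 : ∀ a, τ a = 0 ↔ a ∉ P := fun a => by by_cases ha : a ∈ P <;> simp [τ, ha]
    have hτ1 : ∀ a, τ a ≠ 1 := fun a => by by_cases ha : a ∈ P <;> simp [τ, ha]
    have hτ2 : ∀ a, τ a = 2 ↔ a ∈ P := fun a => by by_cases ha : a ∈ P <;> simp [τ, ha]
    have hz0 : ∀ a, τ a = 0 → a ∈ Z := fun a ha => by
      rw [hτ0, hP] at ha; simpa [Z] using ha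
    have hPτ : ∀ a, τ a ≠ 0 → a ∈ P := fun a ha => by simpa [hτ0] using ha
    have hUZ : ∀ y ∈ U, ∀ z, τ z = 0 → y ∉ r z := fun y hy z hz => by
      obtain ⟨b, hb, hyb⟩ := exists_mem_of_clique h3 hf hinj hy
      exact hnotZ b hb _ hyb z (hz0 z hz)
    have hc1 : #{a | τ a = 1} = 0 := by simp [hτ1]
    have hc2 : #{a | τ a = 2} = #P := by simp [hτ2]
    have hcases : #P = n + 2 ∨ #P = n + 1 := by omega
    rcases hcases with hPc | hPc
    · obtain ⟨x, hx, hxz⟩ := exists_not_mem_rows r hβ τ f fun a ha => hZ a (hz0 a ha)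
      have himg : P.image f = U := eq_of_subset_of_card_le hsub (by omega)
      obtain ⟨e, he⟩ := h.exists_equiv_stdRows hβ true false false τ f x
        (fun a ha => hZ a (hz0 a ha))
        (fun a b ha hb hab => hinj (hPτ a ha) (hPτ b hb) hab)
        (fun a z ha hz => hUZ _ (hf a (hPτ a ha)).1 z hz) hx hxz
        (fun a ha => absurd ha (hτ1 a))
        (fun a ha y => by
          rw [(hf a ((hτ2 a).mp ha)).2, ← himg]
          simp [hτ1, hτ2, eq_comm])
      refine ⟨_, _, _, τ, e, ?_, he⟩
      rw [hc1, hc2, ← hsum, hPc, mul_comm]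
      exact StdParam.L n hn
    -- Exactly one point of `U` is omitted by no row; it is the vertex joined to a whole part in
    -- `H`.
    · obtain ⟨x, hx⟩ : ∃ x, U \ P.image f = {x} := by
        rw [← card_eq_one, card_sdiff_of_subset hsub]; omega
      have hxU : x ∈ U \ P.image f := hx ▸ mem_singleton_self x
      rw [mem_sdiff] at hxU
      have hUeq : ∀ y, y ∈ U ↔ y = x ∨ ∃ a ∈ P, f a = y := by
        intro y
        rw [← mem_image, ← mem_singleton, ← hx, ← mem_union, sdiff_union_of_subset hsub]
      obtain ⟨e, he⟩ := h.exists_equiv_stdRows hβ true false true τ f x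
        (fun a ha => hZ a (hz0 a ha))
        (fun a b ha hb hab => hinj (hPτ a ha) (hPτ b hb) hab)
        (fun a z ha hz => hUZ _ (hf a (hPτ a ha)).1 z hz)
        (fun a ha hxa => hxU.2 (mem_image.mpr ⟨a, hPτ a ha, hxa.symm⟩))
        (fun z hz => hUZ x hxU.1 z hz)
        (fun a ha => absurd ha (hτ1 a))
        (fun a ha y => by
          have hxa : x ≠ f a := fun hxa =>
            hxU.2 (mem_image.mpr ⟨a, (hτ2 a).mp ha, hxa.symm⟩)
          rw [(hf a ((hτ2 a).mp ha)).2, mem_erase, hUeq]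
          simp only [hτ1, hτ2, eq_comm (a := y)]
          have : x = y → f a ≠ y := fun h1 h2 => hxa (h1.trans h2.symm)
          tauto)
      refine ⟨_, _, _, τ, e, ?_, he⟩
      rw [hc1, hc2, ← hsum, hPc, mul_comm]
      -- The bound `2 ≤ n` comes from `3 ≤ #P = n + 1`.
      exact StdParam.H n (by omega)

end


/-! ### Families with rows of sizes two and five -/

open Finset

section

variable {α β : Type} [Fintype α] [DecidableEq β] [Fintype β] {r : α → Finset β}

/-- The `2`-rows `T` form a star or a triangle, and the `5`-rows `D` share four points or lie in a
`6`-set. Each `5`-row contains all points of the `2`-rows, while at most `#T + #D + 1` points are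
covered in all. These two facts determine `#T` and `#D`, except that `#D` stays free for `R` and
`Q`. -/
theorem RowCond.isStandard_of_two_five (h : RowCond r)
    (hβ : Fintype.card β = Fintype.card α + 1) (hT : ∃ a, #(r a) = 2) (hD : ∃ a, #(r a) = 5)
    (hr : ∀ a, #(r a) = 1 ∨ #(r a) = 2 ∨ #(r a) = 5) : IsStandard r := by
  classical
  let Z : Finset α := {a | #(r a) = 1}
  let T : Finset α := {a | #(r a) = 2}
  let D : Finset α := {a | #(r a) = 5}
  let τ : α → Fin 3 := fun a => if #(r a) = 1 then 0 else if #(r a) = 2 then 1 else 2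
  have hτ0 : ∀ a, τ a = 0 ↔ #(r a) = 1 := fun a => by
    rcases hr a with ha | ha | ha <;> simp [τ, ha]
  have hτ1 : ∀ a, τ a = 1 ↔ a ∈ T := fun a => by
    rcases hr a with ha | ha | ha <;> simp [τ, T, ha]
  have hτ2 : ∀ a, τ a = 2 ↔ a ∈ D := fun a => by
    rcases hr a with ha | ha | ha <;> simp [τ, D, ha]
  have hτn : ∀ a, τ a ≠ 0 ↔ a ∈ T ∨ a ∈ D := fun a => by
    rcases hr a with ha | ha | ha <;> simp [τ, T, D, ha]
  have hTD : ∀ a, a ∈ T → a ∉ D := fun a => by simp +contextual [T, D]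
  have hZ : ∀ a ∈ Z, #(r a) = 1 := by simp [Z]
  have hT2 : ∀ a ∈ T, #(r a) = 1 + 1 := by simp [T]
  have hD5 : ∀ a ∈ D, #(r a) = 4 + 1 := by simp [D]
  have hTc : #{a | τ a = 1} = #T := by simp [hτ1]
  have hDc : #{a | τ a = 2} = #D := by simp [hτ2]
  have hsub : ∀ a ∈ T, ∀ b ∈ D, r a ⊆ r b := fun a ha b hb =>
    h.subset_of_card (hT2 a ha) (hD5 b hb)
  have hcount : #Z + #T + #D = Fintype.card α := by
    have e1 : #Z = ∑ a, if #(r a) = 1 then 1 else 0 := by simp [Z]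
    have e2 : #T = ∑ a, if #(r a) = 2 then 1 else 0 := by simp [T]
    have e3 : #D = ∑ a, if #(r a) = 5 then 1 else 0 := by simp [D]
    rw [e1, e2, e3, ← sum_add_distrib, ← sum_add_distrib, ← card_univ, card_eq_sum_ones]
    refine sum_congr rfl fun a _ => ?_
    rcases hr a with ha | ha | ha <;> simp [ha]
  -- This is the sum condition minus the count of rows.
  have hsum : #T + 4 * #D = Fintype.card α := by
    have e1 : #Z = ∑ a, if #(r a) = 1 then 1 else 0 := by simp [Z]
    have e2 : #T = ∑ a, if #(r a) = 2 then 1 else 0 := by simp [T]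
    have e3 : #D = ∑ a, if #(r a) = 5 then 1 else 0 := by simp [D]
    have e4 : #Z + 2 * #T + 5 * #D = ∑ a, #(r a) := by
      rw [e1, e2, e3, mul_sum, mul_sum, ← sum_add_distrib, ← sum_add_distrib]
      refine sum_congr rfl fun a _ => ?_
      rcases hr a with ha | ha | ha <;> simp [ha]
    rw [h.sum] at e4
    omega
  have hTne : T.Nonempty := by
    obtain ⟨a, ha⟩ := hT
    exact ⟨a, by simp [T, ha]⟩
  have hDne : D.Nonempty := by
    obtain ⟨a, ha⟩ := hD
    exact ⟨a, by simp [D, ha]⟩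
  have hTpos := card_pos.mpr hTne
  have hDpos := card_pos.mpr hDne
  have hz0 : ∀ a, τ a = 0 → #(r a) = 1 := fun a => (hτ0 a).mp
  have hrZ : ∀ a, a ∈ T ∨ a ∈ D → ∀ y ∈ r a, ∀ z, τ z = 0 → y ∉ r z := by
    intro a ha y hy z hz
    refine h.not_mem_of_card_eq_one (hz0 z hz) ?_ hy
    rintro rfl
    exact (hτn _).mpr ha hz
  have hle : ∀ V : Finset β, (∀ y ∈ V, ∃ a, (a ∈ T ∨ a ∈ D) ∧ y ∈ r a) → #V ≤ #T + #D + 1 := by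
    intro V hV
    have := h.card_add_card_le V hZ fun y hy z hz => by
      obtain ⟨a, ha, hya⟩ := hV y hy
      exact hrZ a ha y hya z ((hτ0 z).mpr (hZ z hz))
    omega
  -- the representatives of the rows of kinds `1` and `2`, glued
  have glue : ∀ f g : α → β, Set.InjOn f T → Set.InjOn g D → (∀ a ∈ T, ∀ b ∈ D, f a ≠ g b) →
      (∀ a ∈ T, ∀ z, τ z = 0 → f a ∉ r z) → (∀ a ∈ D, ∀ z, τ z = 0 → g a ∉ r z) →
      ∃ φ : α → β, (∀ a ∈ T, φ a = f a) ∧ (∀ a ∈ D, φ a = g a) ∧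
        (∀ a b, τ a ≠ 0 → τ b ≠ 0 → φ a = φ b → a = b) ∧
        (∀ a z, τ a ≠ 0 → τ z = 0 → φ a ∉ r z) := by
    intro f g hf hg hfg hfz hgz
    have h1 : ∀ a ∈ T, (if a ∈ T then f a else g a) = f a := fun a ha => if_pos ha
    have h2 : ∀ a ∈ D, (if a ∈ T then f a else g a) = g a := fun a ha =>
      if_neg fun h => hTD a h ha
    refine ⟨fun a => if a ∈ T then f a else g a, h1, h2, ?_, ?_⟩
    · intro a b ha hb hab
      rw [hτn] at ha hb
      simp only at hab
      rcases ha with ha | ha <;> rcases hb with hb | hb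
      · rw [h1 a ha, h1 b hb] at hab
        exact hf ha hb hab
      · rw [h1 a ha, h2 b hb] at hab
        exact absurd hab (hfg a ha b hb)
      · rw [h2 a ha, h1 b hb] at hab
        exact absurd hab.symm (hfg b hb a ha)
      · rw [h2 a ha, h2 b hb] at hab
        exact hg ha hb hab
    · intro a z ha hz
      rw [hτn] at ha
      simp only
      rcases ha with ha | ha
      · rw [h1 a ha]; exact hfz a ha z hz
      · rw [h2 a ha]; exact hgz a ha z hz
  have hTint := fun a ha b hb hab => h.card_inter (a := a) (b := b) hab (hT2 a ha) (hT2 b hb)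
  have hDint := fun a ha b hb hab => h.card_inter (a := a) (b := b) hab (hD5 a ha) (hD5 b hb)
  have hTimg : ∀ (f φ : α → β), (∀ a ∈ T, φ a = f a) → ∀ y, (∃ b, τ b = 1 ∧ y = φ b) ↔
      y ∈ T.image f := by
    intro f φ hφ y
    simp only [mem_image, hτ1]
    exact exists_congr fun b => and_congr_right fun hb => by rw [hφ b hb, eq_comm]
  have hDimg : ∀ (f φ : α → β), (∀ a ∈ D, φ a = f a) → ∀ y, (∃ b, τ b = 2 ∧ y = φ b) ↔
      y ∈ D.image f := by
    intro f φ hφ y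
    simp only [mem_image, hτ2]
    exact exists_congr fun b => and_congr_right fun hb => by rw [hφ b hb, eq_comm]
  rcases sunflower_or_clique hT2 hTint hTne (W := ∅) (by simp) (by simp) with
    ⟨C, f, -, hC, hf, hfinj⟩ | ⟨U, f, hU, hT3, hf, hfinj⟩
  · obtain ⟨x, rfl⟩ := card_eq_one.mp hC
    have hTr : ∀ a ∈ T, ∀ y, y ∈ r a ↔ y = f a ∨ y = x := fun a ha y => by
      rw [(hf a ha).2]; simp
    have hxf : ∀ a ∈ T, x ≠ f a := fun a ha hxa => (hf a ha).1 (by simp [hxa])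
    obtain ⟨a₀, ha₀⟩ := hTne
    obtain ⟨b₀, hb₀⟩ := hDne
    have hxz : ∀ z, τ z = 0 → x ∉ r z := hrZ a₀ (Or.inl ha₀) x ((hTr a₀ ha₀ x).mpr (Or.inr rfl))
    have hfz : ∀ a ∈ T, ∀ z, τ z = 0 → f a ∉ r z := fun a ha =>
      hrZ a (Or.inl ha) _ ((hTr a ha _).mpr (Or.inl rfl))
    have h1 : ∀ φ : α → β, (∀ a ∈ T, φ a = f a) → ∀ a, τ a = 1 → ∀ y, y ∈ r a ↔
        (true = true ∧ (y = φ a ∨ y = x)) ∨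
          (true = false ∧ y ≠ φ a ∧ ∃ b, τ b = 1 ∧ y = φ b) := by
      intro φ hφ a ha y
      rw [hτ1] at ha
      rw [hTr a ha, hφ a ha]
      simp
    have hxim : x ∉ T.image f := fun hx => by
      obtain ⟨a, ha, hxa⟩ := mem_image.mp hx
      exact hxf a ha hxa.symm
    have hWc : #(insert x (T.image f)) = #T + 1 := by
      rw [card_insert_of_notMem hxim, card_image_of_injOn hfinj]
    have hW : ∀ b ∈ D, insert x (T.image f) ⊆ r b := by
      intro b hb
      refine insert_subset (hsub a₀ ha₀ b hb ((hTr a₀ ha₀ x).mpr (Or.inr rfl))) ?_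
      exact image_subset_iff.mpr fun a ha => hsub a ha b hb ((hTr a ha _).mpr (Or.inl rfl))
    -- The star `T` has `#T + 1` points. They fit in a four-point kernel only if `#T ≤ 3`; otherwise
    -- they already fill a `5`-row.
    by_cases hT3 : #T ≤ 3
    · rcases sunflower_or_clique hD5 hDint ⟨b₀, hb₀⟩ hW (by omega) with
        ⟨C, g, hWC, hC4, hg, hginj⟩ | ⟨U, g, hU, hD3, hg, hginj⟩
      · have hgC : ∀ b ∈ D, g b ∈ r b := fun b hb => (hg b hb).2 ▸ mem_insert_self _ _
        have hV : #(C ∪ D.image g) = 4 + #D := by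
          rw [card_union_of_disjoint, hC4, card_image_of_injOn hginj]
          refine disjoint_left.mpr fun y hy hy' => ?_
          obtain ⟨b, hb, rfl⟩ := mem_image.mp hy'
          exact (hg b hb).1 hy
        have hVle := hle (C ∪ D.image g) (by
          intro y hy
          rcases mem_union.mp hy with hy | hy
          · exact ⟨b₀, Or.inr hb₀, (hg b₀ hb₀).2 ▸ mem_insert_of_mem hy⟩
          · obtain ⟨b, hb, rfl⟩ := mem_image.mp hy
            exact ⟨b, Or.inr hb, hgC b hb⟩)
        -- The kernel and the private points number `4 + #D`, at most `#T + #D + 1`.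
        have hTeq : #T = 3 := by omega
        have hWC' : insert x (T.image f) = C := eq_of_subset_of_card_le hWC (by omega)
        obtain ⟨φ, hφT, hφD, hφ, hφz⟩ := glue f g hfinj hginj
          (fun a ha b hb hab => (hg b hb).1 (hab ▸ hWC (mem_insert_of_mem (mem_image_of_mem f ha))))
          hfz (fun b hb => hrZ b (Or.inr hb) _ (hgC b hb))
        obtain ⟨e, he⟩ := h.exists_equiv_stdRows hβ true true true τ φ x hz0 hφ hφz
          (fun a ha => by
            rcases (hτn a).mp ha with ha | ha
            · rw [hφT a ha]; exact hxf a ha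
            · rw [hφD a ha]
              exact fun hxa => (hg a ha).1 (hxa ▸ hWC (mem_insert_self _ _)))
          hxz (h1 φ hφT)
          (fun a ha y => by
            rw [hτ2] at ha
            rw [hTimg f φ hφT, (hg a ha).2, ← hWC', hφD a ha]
            simp only [mem_insert]
            tauto)
        refine ⟨_, _, _, τ, e, ?_, he⟩
        rw [hTc, hDc, ← hsum, hTeq, add_comm]
        exact StdParam.R _ hDpos
      · have hgU : ∀ b ∈ D, g b ∈ U := fun b hb => (hg b hb).1
        have hdisj : Disjoint (insert x (T.image f)) (D.image g) := by
          refine disjoint_left.mpr fun y hy hy' => ?_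
          obtain ⟨b, hb, rfl⟩ := mem_image.mp hy'
          have := hW b hb hy
          rw [(hg b hb).2] at this
          exact notMem_erase _ _ this
        have hVU : insert x (T.image f) ∪ D.image g ⊆ U := by
          refine union_subset ((hW b₀ hb₀).trans ?_) (image_subset_iff.mpr hgU)
          rw [(hg b₀ hb₀).2]
          exact erase_subset _ _
        have hVc : #(insert x (T.image f) ∪ D.image g) = #T + 1 + #D := by
          rw [card_union_of_disjoint hdisj, hWc, card_image_of_injOn hginj]
        have hc1 := card_le_card hVU
        have hUr : ∀ y ∈ U, ∃ b ∈ D, y ∈ r b := fun y hy => exists_mem_of_clique hD3 hg hginj hy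
        have hc2 := hle U fun y hy => by
          obtain ⟨b, hb, hyb⟩ := hUr y hy
          exact ⟨b, Or.inr hb, hyb⟩
        -- Both bounds on the six points of `U` are tight: `#T + 1 + #D ≤ 6 ≤ #T + #D + 1`. Hence
        -- `#T + #D = 5`, and `3 ≤ #D` leaves only `G₃` and `G₄`.
        have hVU' : insert x (T.image f) ∪ D.image g = U := eq_of_subset_of_card_le hVU (by omega)
        rw [disjoint_left] at hdisj
        obtain ⟨φ, hφT, hφD, hφ, hφz⟩ := glue f g hfinj hginj
          (fun a ha b hb hab => hdisj (mem_insert_of_mem (mem_image_of_mem f ha))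
            (hab ▸ mem_image_of_mem g hb)) hfz (fun b hb z hz => by
            obtain ⟨b', hb', hgb⟩ := hUr _ (hgU b hb)
            exact hrZ b' (Or.inr hb') _ hgb z hz)
        obtain ⟨e, he⟩ := h.exists_equiv_stdRows hβ true false true τ φ x hz0 hφ hφz
          (fun a ha => by
            rcases (hτn a).mp ha with ha | ha
            · rw [hφT a ha]; exact hxf a ha
            · rw [hφD a ha]
              exact fun hxa => hdisj (mem_insert_self _ _) (hxa ▸ mem_image_of_mem g ha))
          hxz (h1 φ hφT)
          (fun a ha y => by
            rw [hτ2] at ha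
            rw [hTimg f φ hφT, hDimg g φ hφD, (hg a ha).2, ← hVU', hφD a ha, mem_erase,
              mem_union, mem_insert]
            have h3 : y = x ∨ y ∈ T.image f → y ≠ g a := fun hy hya =>
              hdisj (mem_insert.mpr hy) (hya ▸ mem_image_of_mem g ha)
            have : (true = true) = True := by simp
            have : (false = true) = False := by simp
            simp only [true_and, *]
            tauto)
        refine ⟨_, _, _, τ, e, ?_, he⟩
        rw [hTc, hDc, ← hsum]
        have hcases : (#T = 1 ∧ #D = 4) ∨ (#T = 2 ∧ #D = 3) := by omega
        rcases hcases with ⟨h3, h4⟩ | ⟨h3, h4⟩ <;> rw [h3, h4]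
        · exact StdParam.G3
        · exact StdParam.G4
    · have hWr : ∀ b ∈ D, insert x (T.image f) = r b := fun b hb =>
        eq_of_subset_of_card_le (hW b hb) (by rw [hD5 b hb]; omega)
      have hT4 : #T = 4 := by
        have := card_le_card (hW b₀ hb₀)
        rw [hD5 b₀ hb₀] at this
        omega
      -- All `5`-rows equal the point set of the star, whereas distinct ones would meet in four
      -- points only.
      have hD1 : #D = 1 := by
        refine le_antisymm (card_le_one.mpr fun a ha b hb => ?_) hDpos
        by_contra hab
        have := hDint a ha b hb hab
        rw [← hWr a ha, ← hWr b hb, inter_self] at this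
        omega
      obtain ⟨d, hd⟩ := card_eq_one.mp hD1
      have hDd : ∀ b, b ∈ D ↔ b = d := fun b => by rw [hd, mem_singleton]
      -- The single `5`-row has no private point. The uncovered point `y₀` serves as its
      -- representative and becomes the isolated vertex next to `G₁`.
      obtain ⟨y₀, hy₀, hyz⟩ := exists_not_mem_rows r hβ τ (fun a => if a ∈ T then f a else x) hz0
      have hyf : ∀ a ∈ T, f a ≠ y₀ := fun a ha hay =>
        hy₀ a ((hτn a).mpr (Or.inl ha)) (by simp [ha, hay])
      have hyx : x ≠ y₀ := fun hxy =>
        hy₀ d ((hτn d).mpr (Or.inr ((hDd d).mpr rfl)))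
          (by rw [if_neg fun h => hTD d h ((hDd d).mpr rfl), hxy])
      obtain ⟨φ, hφT, hφD, hφ, hφz⟩ := glue f (fun _ => y₀) hfinj
        (fun a ha b hb _ => ((hDd a).mp ha).trans ((hDd b).mp hb).symm) (fun a ha _ _ => hyf a ha)
        hfz (fun _ _ => hyz)
      obtain ⟨e, he⟩ := h.exists_equiv_stdRows hβ true false true τ φ x hz0 hφ hφz
        (fun a ha => by
          rcases (hτn a).mp ha with ha | ha
          · rw [hφT a ha]; exact hxf a ha
          · rw [hφD a ha]; exact hyx)
        hxz (h1 φ hφT)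
        (fun a ha y => by
          rw [hτ2] at ha
          rw [hTimg f φ hφT, hDimg (fun _ => y₀) φ hφD, ← hWr a ha, hφD a ha, mem_insert]
          simp +contextual [hd])
      refine ⟨_, _, _, τ, e, ?_, he⟩
      rw [hTc, hDc, ← hsum, hT4, hD1]
      exact StdParam.G1
  · have hTcard : #(T.image f) = #T := card_image_of_injOn hfinj
    have himg : T.image f ⊆ U := image_subset_iff.mpr fun a ha => (hf a ha).1
    have hT3' : #T = 3 := by
      have := card_le_card himg
      omega
    have himg' : T.image f = U := eq_of_subset_of_card_le himg (by omega)
    have hUr : ∀ y ∈ U, ∃ a ∈ T, y ∈ r a := fun y hy => exists_mem_of_clique hT3 hf hfinj hy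
    have hfz : ∀ a ∈ T, ∀ z, τ z = 0 → f a ∉ r z := fun a ha => by
      obtain ⟨b, hb, hab⟩ := hUr _ (hf a ha).1
      exact hrZ b (Or.inl hb) _ hab
    have hW : ∀ b ∈ D, U ⊆ r b := fun b hb y hy => by
      obtain ⟨a, ha, hya⟩ := hUr y hy
      exact hsub a ha b hb hya
    have h1 : ∀ (φ : α → β) (x : β), (∀ a ∈ T, φ a = f a) → ∀ a, τ a = 1 → ∀ y, y ∈ r a ↔
        (false = true ∧ (y = φ a ∨ y = x)) ∨
          (false = false ∧ y ≠ φ a ∧ ∃ b, τ b = 1 ∧ y = φ b) := by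
      intro φ x hφ a ha y
      rw [hτ1] at ha
      rw [(hf a ha).2, hTimg f φ hφ, himg', hφ a ha, mem_erase]
      simp
    obtain ⟨b₀, hb₀⟩ := hDne
    rcases sunflower_or_clique hD5 hDint ⟨b₀, hb₀⟩ hW (by omega) with
      ⟨C, g, hUC, hC4, hg, hginj⟩ | ⟨U', g, hU', hD3, hg, hginj⟩
    · have hgC : ∀ b ∈ D, g b ∈ r b := fun b hb => (hg b hb).2 ▸ mem_insert_self _ _
      -- The four-point kernel consists of the triangle `U` and one point `x`: the case `Q`.
      obtain ⟨x, hx⟩ : ∃ x, C \ U = {x} := by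
        rw [← card_eq_one, card_sdiff_of_subset hUC]; omega
      have hxC : x ∈ C ∧ x ∉ U := mem_sdiff.mp (hx ▸ mem_singleton_self x)
      have hCeq : C = insert x U := by
        rw [← sdiff_union_of_subset hUC, hx, insert_eq]
      obtain ⟨φ, hφT, hφD, hφ, hφz⟩ := glue f g hfinj hginj
        (fun a ha b hb hab => (hg b hb).1 (hab ▸ hUC (hf a ha).1))
        hfz (fun b hb => hrZ b (Or.inr hb) _ (hgC b hb))
      obtain ⟨e, he⟩ := h.exists_equiv_stdRows hβ false true true τ φ x hz0 hφ hφz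
        (fun a ha => by
          rcases (hτn a).mp ha with ha | ha
          · rw [hφT a ha]; exact fun hxa => hxC.2 (hxa ▸ (hf a ha).1)
          · rw [hφD a ha]; exact fun hxa => (hg a ha).1 (hxa ▸ hxC.1))
        (hrZ b₀ (Or.inr hb₀) x ((hg b₀ hb₀).2 ▸ mem_insert_of_mem hxC.1))
        (h1 φ x hφT)
        (fun a ha y => by
          rw [hτ2] at ha
          rw [hTimg f φ hφT, himg', (hg a ha).2, hCeq, hφD a ha]
          simp only [mem_insert]
          tauto)
      refine ⟨_, _, _, τ, e, ?_, he⟩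
      rw [hTc, hDc, ← hsum, hT3', add_comm]
      exact StdParam.Q _ hDpos
    · have hgU : ∀ b ∈ D, g b ∈ U' := fun b hb => (hg b hb).1
      have hdisj : Disjoint U (D.image g) := by
        refine disjoint_left.mpr fun y hy hy' => ?_
        obtain ⟨b, hb, rfl⟩ := mem_image.mp hy'
        have := hW b hb hy
        rw [(hg b hb).2] at this
        exact notMem_erase _ _ this
      have hVU : U ∪ D.image g ⊆ U' := by
        refine union_subset ((hW b₀ hb₀).trans ?_) (image_subset_iff.mpr hgU)
        rw [(hg b₀ hb₀).2]
        exact erase_subset _ _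
      have hVc : #(U ∪ D.image g) = 3 + #D := by
        rw [card_union_of_disjoint hdisj, hU, card_image_of_injOn hginj]
      have hc1 := card_le_card hVU
      -- The triangle and the points omitted by the `5`-rows are disjoint in a `6`-set, so `#D ≤ 3`;
      -- the clique alternative gives `3 ≤ #D`.
      have hD3' : #D = 3 := by omega
      have hUr' : ∀ y ∈ U', ∃ b ∈ D, y ∈ r b := fun y hy => exists_mem_of_clique hD3 hg hginj hy
      have hVU' : U ∪ D.image g = U' := eq_of_subset_of_card_le hVU (by omega)
      rw [disjoint_left] at hdisj
      obtain ⟨φ, hφT, hφD, hφ, hφz⟩ := glue f g hfinj hginj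
        (fun a ha b hb hab => hdisj (hf a ha).1 (hab ▸ mem_image_of_mem g hb)) hfz
        (fun b hb z hz => by
          obtain ⟨b', hb', hgb⟩ := hUr' _ (hgU b hb)
          exact hrZ b' (Or.inr hb') _ hgb z hz)
      obtain ⟨x, hx, hxz⟩ := exists_not_mem_rows r hβ τ φ hz0
      obtain ⟨e, he⟩ := h.exists_equiv_stdRows hβ false false false τ φ x hz0 hφ hφz hx hxz
        (h1 φ x hφT)
        (fun a ha y => by
          rw [hτ2] at ha
          rw [hTimg f φ hφT, hDimg g φ hφD, (hg a ha).2, ← hVU', himg', hφD a ha, mem_erase,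
            mem_union]
          have h3 : y ∈ U → y ≠ g a := fun hy hya => hdisj hy (hya ▸ mem_image_of_mem g ha)
          simp only [Bool.false_eq_true, false_and, true_and, false_or]
          tauto)
      refine ⟨_, _, _, τ, e, ?_, he⟩
      rw [hTc, hDc, ← hsum, hT3', hD3']
      exact StdParam.G2

theorem RowCond.isStandard (h : RowCond r) (hα : 1 ≤ Fintype.card α)
    (hβ : Fintype.card β = Fintype.card α + 1) : IsStandard r := by
  rcases h.uniform_or_two_five hα with ⟨n, hn, hr⟩ | ⟨hT, hD, hr⟩
  · exact h.isStandard_of_uniform hα hβ hn hr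
  · exact h.isStandard_of_two_five hβ hT hD hr

end


open Finset

/-! ### Standard families satisfy `RowCond` -/

section

variable {α : Type} [Fintype α] {p o s : Bool} {τ : α → Fin 3}

theorem card_finset_option [DecidableEq α] (S : Finset (Option α)) :
    #S = (if none ∈ S then 1 else 0) + #{b | some b ∈ S} := by
  have : #S = ∑ c : Option α, if c ∈ S then 1 else 0 := by simp
  rw [this, Fintype.sum_option]
  simp

theorem card_stdRows_zero {a : α} (ha : τ a = 0) : #(stdRows p o s τ a) = 1 := by
  classical
  rw [card_finset_option]
  simp only [none_mem_stdRows, some_mem_stdRows, ha]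
  simpa using card_eq_one.mpr ⟨a, by ext; simp⟩

theorem card_stdRows_one {a : α} (ha : τ a = 1) :
    #(stdRows p o s τ a) = if p then 2 else #{b | τ b = 1} - 1 := by
  classical
  rw [card_finset_option]
  cases p
  · have : #{b | τ b = 1} - 1 = #(({b | τ b = 1} : Finset α).erase a) := by
      rw [card_erase_of_mem (by simp [ha])]
    simp only [Bool.false_eq_true, if_false, this, none_mem_stdRows, some_mem_stdRows, ha]
    simp only [Fin.isValue, one_ne_zero, and_false, false_and, or_self, if_false,
      false_or, true_and, or_false, zero_add, show (1 : Fin 3) ≠ 2 by decide]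
    congr 1
    ext b; simp [and_comm]
  · rw [if_pos (by simp [none_mem_stdRows, ha]), if_pos rfl]
    refine congrArg (1 + ·) (card_eq_one.mpr ⟨a, ?_⟩)
    ext b; simp [some_mem_stdRows, ha]

theorem card_stdRows_two {a : α} (ha : τ a = 2) : #(stdRows p o s τ a) =
    (if s then 1 else 0) + (#{b | τ b = 1} + if o then 1 else #{b | τ b = 2} - 1) := by
  classical
  rw [card_finset_option]
  congr 1
  · simp [none_mem_stdRows, ha]
  have haT : a ∉ ({b | τ b = 1} : Finset α) := by simp [ha]
  cases o
  · have h1 : #{b | τ b = 2} - 1 = #(({b | τ b = 2} : Finset α).erase a) := by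
      rw [card_erase_of_mem (by simp [ha])]
    have h2 : Disjoint ({b | τ b = 1} : Finset α) (({b | τ b = 2} : Finset α).erase a) := by
      rw [disjoint_left]; intro b; simp +contextual
    simp only [Bool.false_eq_true, if_false]
    rw [h1, ← card_union_of_disjoint h2]
    congr 1
    ext b; simp [some_mem_stdRows, ha, and_comm]
  · rw [if_pos rfl, ← card_insert_of_notMem haT]
    congr 1
    ext b; simp [some_mem_stdRows, ha, or_comm]

section

variable [DecidableEq α]

theorem card_stdRows_inter_zero {a b : α} (ha : τ a = 0) (hab : a ≠ b) :
    #(stdRows p o s τ a ∩ stdRows p o s τ b) = 0 := by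
  rw [card_eq_zero, eq_empty_iff_forall_notMem]
  rintro (_ | c) hc
  · simp [none_mem_stdRows, ha] at hc
  · simp only [mem_inter, some_mem_stdRows, ha] at hc
    obtain ⟨h1, h2⟩ := hc
    have hca : c = a := by simpa using h1
    subst hca
    simp [ha, hab] at h2

theorem card_stdRows_inter_one_one {a b : α} (ha : τ a = 1) (hb : τ b = 1) (hab : a ≠ b) :
    #(stdRows p o s τ a ∩ stdRows p o s τ b) = if p then 1 else #{b | τ b = 1} - 2 := by
  rw [card_finset_option]
  cases p
  · have h1 : #{b | τ b = 1} - 2 = #((({b | τ b = 1} : Finset α).erase a).erase b) := by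
      rw [card_erase_of_mem (by simp [hb, hab.symm]), card_erase_of_mem (by simp [ha])]; rfl
    simp only [Bool.false_eq_true, if_false, h1]
    rw [if_neg (by simp [none_mem_stdRows, ha]), zero_add]
    congr 1
    ext c; simp [some_mem_stdRows, ha, hb]; tauto
  · rw [if_pos (by simp [none_mem_stdRows, ha, hb]), if_pos rfl, Nat.add_eq_left, card_eq_zero,
      eq_empty_iff_forall_notMem]
    intro c hc
    simp [some_mem_stdRows, ha, hb] at hc
    exact hab (hc.1.symm.trans hc.2)

theorem card_stdRows_inter_one_two {a b : α} (ha : τ a = 1) (hb : τ b = 2) :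
    #(stdRows p o s τ a ∩ stdRows p o s τ b) =
      if p then (if s then 1 else 0) + 1 else #{b | τ b = 1} - 1 := by
  rw [card_finset_option]
  cases p
  · have h1 : #{b | τ b = 1} - 1 = #(({b | τ b = 1} : Finset α).erase a) := by
      rw [card_erase_of_mem (by simp [ha])]
    simp only [Bool.false_eq_true, if_false, h1]
    rw [if_neg (by simp [none_mem_stdRows, ha]), zero_add]
    congr 1
    ext c; simp [some_mem_stdRows, ha, hb]; tauto
  · rw [if_pos rfl]
    congr 1
    · simp [none_mem_stdRows, ha, hb]
    · rw [card_eq_one]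
      refine ⟨a, ?_⟩
      ext c
      simp only [mem_filter, mem_univ, mem_inter, some_mem_stdRows, ha, hb, mem_singleton]
      constructor
      · rintro ⟨-, h1, -⟩; simpa using h1
      · rintro rfl; simp [ha]

theorem card_stdRows_inter_two_two {a b : α} (ha : τ a = 2) (hb : τ b = 2) (hab : a ≠ b) :
    #(stdRows p o s τ a ∩ stdRows p o s τ b) =
      (if s then 1 else 0) + (#{b | τ b = 1} + if o then 0 else #{b | τ b = 2} - 2) := by
  rw [card_finset_option]
  congr 1
  · simp [none_mem_stdRows, ha, hb]
  cases o
  · have h1 : #{b | τ b = 2} - 2 = #((({b | τ b = 2} : Finset α).erase a).erase b) := by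
      rw [card_erase_of_mem (by simp [hb, hab.symm]), card_erase_of_mem (by simp [ha])]; rfl
    have h2 : Disjoint ({b | τ b = 1} : Finset α)
        ((({b | τ b = 2} : Finset α).erase a).erase b) := by
      rw [disjoint_left]; intro b; simp +contextual
    simp only [Bool.false_eq_true, if_false]
    rw [h1, ← card_union_of_disjoint h2]
    congr 1
    ext c; simp [some_mem_stdRows, ha, hb]; tauto
  · rw [if_pos rfl, add_zero]
    congr 1
    ext c
    simp only [mem_filter, mem_univ, mem_inter, some_mem_stdRows, ha, hb]
    constructor
    · rintro ⟨-, h1, h2⟩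
      by_contra h3
      have h3' : τ c ≠ 1 := fun h => h3 (by simp [h])
      have h4 : c = a := by simpa [h3'] using h1
      have h5 : c = b := by simpa [h3'] using h2
      exact hab (h4.symm.trans h5)
    · intro h1; simp [h1]

end

theorem kind_cases (i : Fin 3) : i = 0 ∨ i = 1 ∨ i = 2 := by fin_cases i <;> simp

theorem sum_kinds (f : α → ℕ) (c₀ c₁ c₂ : ℕ) (h₀ : ∀ a, τ a = 0 → f a = c₀)
    (h₁ : ∀ a, τ a = 1 → f a = c₁) (h₂ : ∀ a, τ a = 2 → f a = c₂) :
    ∑ a, f a = #{a | τ a = 0} * c₀ + #{a | τ a = 1} * c₁ + #{a | τ a = 2} * c₂ := by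
  simp only [card_filter, sum_mul, ← sum_add_distrib]
  refine sum_congr rfl fun a _ => ?_
  rcases kind_cases (τ a) with h | h | h
  · simp [h, h₀]
  · simp [h, h₁]
  · simp [h, h₂]

theorem card_kinds (τ : α → Fin 3) :
    #{a | τ a = 0} + #{a | τ a = 1} + #{a | τ a = 2} = Fintype.card α := by
  have := sum_kinds (τ := τ) (fun _ => 1) 1 1 1 (by simp) (by simp) (by simp)
  simpa using this.symm

/-- Sizes and intersections depend only on the kinds of the rows, so `RowCond` becomes a few
numerical identities in `t` and `d`. In `hsum` the contribution of the `k - t - d` singletons has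
been cancelled. -/
theorem rowCond_stdRows_of [DecidableEq α] {t d cT cD iTT iTD iDD : ℕ}
    (ht : #{a | τ a = 1} = t) (hd : #{a | τ a = 2} = d)
    (hcT : cT = if p then 2 else t - 1)
    (hcD : cD = (if s then 1 else 0) + (t + if o then 1 else d - 1))
    (hiTT : iTT = if p then 1 else t - 2)
    (hiTD : iTD = if p then (if s then 1 else 0) + 1 else t - 1)
    (hiDD : iDD = (if s then 1 else 0) + (t + if o then 0 else d - 2))
    (h1 : 1 ≤ t → 1 ≤ cT) (h2 : 1 ≤ d → 1 ≤ cD) (hTT : 2 ≤ t → iTT = cT - 1)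
    (hTD : 1 ≤ t → 1 ≤ d → iTD ^ 2 = (cT - 1) * (cD - 1)) (hDD : 2 ≤ d → iDD = cD - 1)
    (hsum : t * cT + d * cD = Fintype.card α + t + d) : RowCond (stdRows p o s τ) := by
  have hT (a) (ha : τ a = 1) : 1 ≤ t ∧ #(stdRows p o s τ a) = cT :=
    ⟨ht ▸ card_pos.mpr ⟨a, by simp [ha]⟩, by rw [card_stdRows_one ha, hcT, ht]⟩
  have hD (a) (ha : τ a = 2) : 1 ≤ d ∧ #(stdRows p o s τ a) = cD :=
    ⟨hd ▸ card_pos.mpr ⟨a, by simp [ha]⟩, by rw [card_stdRows_two ha, hcD, ht, hd]⟩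
  have hTD' (a b) (ha : τ a = 1) (hb : τ b = 2) :
      #(stdRows p o s τ a ∩ stdRows p o s τ b) ^ 2 =
        (#(stdRows p o s τ a) - 1) * (#(stdRows p o s τ b) - 1) := by
    rw [card_stdRows_inter_one_two ha hb, (hT a ha).2, (hD b hb).2, ht, ← hiTD,
      hTD (hT a ha).1 (hD b hb).1]
  refine ⟨fun a => ?_, fun a b hab => ?_, ?_⟩
  · rcases kind_cases (τ a) with ha | ha | ha
    · rw [card_stdRows_zero ha]
    · rw [(hT a ha).2]; exact h1 (hT a ha).1
    · rw [(hD a ha).2]; exact h2 (hD a ha).1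
  · rcases kind_cases (τ a) with ha | ha | ha
    · simp [card_stdRows_inter_zero ha hab, card_stdRows_zero ha]
    · rcases kind_cases (τ b) with hb | hb | hb
      · rw [inter_comm]
        simp [card_stdRows_inter_zero hb hab.symm, card_stdRows_zero hb]
      · have : 2 ≤ t := ht ▸ one_lt_card.mpr ⟨a, by simp [ha], b, by simp [hb], hab⟩
        rw [card_stdRows_inter_one_one ha hb hab, (hT a ha).2, (hT b hb).2, ht, ← hiTT, hTT this, sq]
      · exact hTD' a b ha hb
    · rcases kind_cases (τ b) with hb | hb | hb
      · rw [inter_comm]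
        simp [card_stdRows_inter_zero hb hab.symm, card_stdRows_zero hb]
      · rw [inter_comm, mul_comm]; exact hTD' b a hb ha
      · have : 2 ≤ d := hd ▸ one_lt_card.mpr ⟨a, by simp [ha], b, by simp [hb], hab⟩
        rw [card_stdRows_inter_two_two ha hb hab, (hD a ha).2, (hD b hb).2, ht, hd, ← hiDD,
          hDD this, sq]
  · rw [sum_kinds (τ := τ) _ 1 cT cD (fun a ha => card_stdRows_zero ha) (fun a ha => (hT a ha).2)
      (fun a ha => (hD a ha).2), ht, hd]
    have := card_kinds τ
    rw [ht, hd] at this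
    omega

theorem rowCond_stdRows [DecidableEq α] {t d k : ℕ} (h : StdParam p o s t d k)
    (ht : #{a | τ a = 1} = t) (hd : #{a | τ a = 2} = d) (hk : Fintype.card α = k) :
    RowCond (stdRows p o s τ) := by
  cases h with
  | star =>
    exact rowCond_stdRows_of ht hd rfl rfl rfl rfl rfl (by simp) (by simp) (by simp)
      (by simp) (by simp) (by simp; omega)
  | L n hn =>
    exact rowCond_stdRows_of ht hd rfl rfl rfl rfl rfl (by simp) (by simp) (by simp)
      (by simp) (by simp) (by simp [hk]; ring)
  | H n hn =>
    exact rowCond_stdRows_of ht hd rfl rfl rfl rfl rfl (by simp) (by simp) (by simp)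
      (by simp) (by simp; omega) (by simp [hk]; ring)
  | R d =>
    exact rowCond_stdRows_of ht hd rfl rfl rfl rfl rfl (by simp) (by simp) (by simp)
      (by simp) (by simp) (by simp [hk]; ring)
  | Q d =>
    exact rowCond_stdRows_of ht hd rfl rfl rfl rfl rfl (by simp) (by simp) (by simp)
      (by simp) (by simp) (by simp [hk]; ring)
  | G1 =>
    exact rowCond_stdRows_of ht hd rfl rfl rfl rfl rfl (by simp) (by simp) (by simp)
      (by simp) (by simp) (by simp [hk])
  | G2 =>
    exact rowCond_stdRows_of ht hd rfl rfl rfl rfl rfl (by simp) (by simp) (by simp)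
      (by simp) (by simp) (by simp [hk])
  | G3 =>
    exact rowCond_stdRows_of ht hd rfl rfl rfl rfl rfl (by simp) (by simp) (by simp)
      (by simp) (by simp) (by simp [hk])
  | G4 =>
    exact rowCond_stdRows_of ht hd rfl rfl rfl rfl rfl (by simp) (by simp) (by simp)
      (by simp) (by simp) (by simp [hk])

end

/-! ### The standard graphs -/

theorem exists_equiv_of_card_fiber {α α' ι : Type} [Fintype α] [Fintype α'] [DecidableEq ι]
    {τ : α → ι} {τ' : α' → ι} (h : ∀ i, #{a | τ a = i} = #{a | τ' a = i}) :
    ∃ e : α ≃ α', ∀ a, τ' (e a) = τ a := by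
  have key : ∀ i, Nonempty ({a // τ a = i} ≃ {a // τ' a = i}) := fun i =>
    ⟨Fintype.equivOfCardEq (by rw [Fintype.card_subtype, Fintype.card_subtype, h])⟩
  let E := fun i => (key i).some
  refine ⟨(Equiv.sigmaFiberEquiv τ).symm.trans
    ((Equiv.sigmaCongrRight E).trans (Equiv.sigmaFiberEquiv τ')), fun a => ?_⟩
  exact (E (τ a) ⟨a, rfl⟩).2

theorem bipF_stdRows_iso {α α' : Type} [Fintype α] [Fintype α'] {p o s : Bool} {τ : α → Fin 3}
    {τ' : α' → Fin 3} (e : α ≃ α') (he : ∀ a, τ' (e a) = τ a) :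
    (bipF (stdRows p o s τ)).Iso (bipF (stdRows p o s τ')) := by
  refine bip_iso_of_equiv e (Equiv.optionCongr e) ?_
  rintro a (_ | b)
  · simp [none_mem_stdRows, he]
  · simp [some_mem_stdRows, he]

/-- The kinds of the rows in a standard family with `d`, `t`, `z` rows of kinds `2`, `1`, `0`. -/
def kind (d t z : ℕ) : (Fin d ⊕ Fin t) ⊕ Fin z → Fin 3 :=
  Sum.elim (Sum.elim (fun _ => 2) fun _ => 1) fun _ => 0

/-- The standard graph with `d`, `t`, `z` rows of kinds `2`, `1`, `0`. -/
noncomputable def stdG (p o s : Bool) (d t z : ℕ) : FinGraph := bipF (stdRows p o s (kind d t z))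

theorem card_kind_zero (d t z : ℕ) : #{a | kind d t z a = 0} = z := by
  rw [card_filter, Fintype.sum_sum_type, Fintype.sum_sum_type]
  simp [kind]

theorem card_kind_one (d t z : ℕ) : #{a | kind d t z a = 1} = t := by
  rw [card_filter, Fintype.sum_sum_type, Fintype.sum_sum_type]
  simp [kind]

theorem card_kind_two (d t z : ℕ) : #{a | kind d t z a = 2} = d := by
  rw [card_filter, Fintype.sum_sum_type, Fintype.sum_sum_type]
  simp [kind]

theorem bipF_stdRows_iso_stdG {α : Type} [Fintype α] (p o s : Bool) {τ : α → Fin 3} {d t z : ℕ}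
    (hd : #{a | τ a = 2} = d) (ht : #{a | τ a = 1} = t) (hz : #{a | τ a = 0} = z) :
    (bipF (stdRows p o s τ)).Iso (stdG p o s d t z) := by
  obtain ⟨e, he⟩ := exists_equiv_of_card_fiber (τ := τ) (τ' := kind d t z) (fun i => by
    rcases kind_cases i with rfl | rfl | rfl
    · rw [hz, card_kind_zero]
    · rw [ht, card_kind_one]
    · rw [hd, card_kind_two])
  exact bipF_stdRows_iso e he

/-- The form in which the classification is used: a standard graph is determined up to isomorphism
by its three flags and the numbers of rows of each kind. -/
theorem spec_eq_graphS_iff_stdG {k : ℕ} (hk : 1 ≤ k) (B : FinGraph) :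
    B.spec = (graphS k).spec ↔ ∃ (p o s : Bool) (d t z : ℕ), StdParam p o s t d k ∧
      d + t + z = k ∧ B.Iso (stdG p o s d t z) := by
  classical
  rw [spec_eq_graphS_iff hk]
  constructor
  · rintro ⟨α, β, _, _, _, r, rfl, hβ, hr, hB⟩
    obtain ⟨p, o, s, τ, e, hp, he⟩ := hr.isStandard hk hβ
    refine ⟨p, o, s, _, _, #{a | τ a = 0}, hp, ?_, hB.trans (Iso.trans ?_
      (bipF_stdRows_iso_stdG p o s rfl rfl rfl))⟩
    · have := card_kinds τ
      omega
    · exact Iso.symm (bip_iso_of_equiv (Equiv.refl _) e he)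
  · rintro ⟨p, o, s, d, t, z, hp, hk', hB⟩
    refine ⟨_, _, _, _, inferInstance, stdRows p o s (kind d t z), ?_, ?_, ?_, hB⟩
    · simp [hk']
    · simp [hk']
    · exact rowCond_stdRows hp (card_kind_one _ _ _) (card_kind_two _ _ _) (by simp [hk'])


open Finset Sum

/-! ### The listed graphs are standard graphs -/

theorem add_right_comm_iso (A B C : FinGraph) : (A + B + C).Iso (A + C + B) := by
  refine Iso.of_equiv (G := (A.graph ⊕g B.graph) ⊕g C.graph)
    (H := (A.graph ⊕g C.graph) ⊕g B.graph)
    ((Equiv.sumAssoc _ _ _).trans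
      (((Equiv.refl _).sumCongr (Equiv.sumComm _ _)).trans (Equiv.sumAssoc _ _ _).symm)) ?_
  rintro ((a | b) | c) ((a' | b') | c') <;> simp

theorem add_zero_smul_K2_iso (A : FinGraph) : (A + 0 • K2).Iso A := by
  refine Iso.of_equiv (G := A.graph ⊕g (0 • K2 : FinGraph).graph) (H := A.graph)
    (@Equiv.sumEmpty A.V (Fin 0 × Fin 2) _) ?_
  rintro (a | b) (a' | b')
  · exact Iff.rfl
  · exact b'.1.elim0
  · exact b.1.elim0
  · exact b.1.elim0

/-- Moving a summand into an option type. -/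
def optionSumEquiv (α β : Type) : Option α ⊕ β ≃ Option (α ⊕ β) where
  toFun := Sum.elim (Option.map inl) fun b => some (inr b)
  invFun := fun c => c.elim (inl none) (Sum.elim (fun a => inl (some a)) inr)
  left_inv := by rintro ((_ | a) | b) <;> rfl
  right_inv := by rintro (_ | (a | b)) <;> rfl

/-- A one-point summand as the additional point of an option type. -/
def sumFinOneEquiv (α : Type) : α ⊕ Fin 1 ≃ Option α where
  toFun := Sum.elim some fun _ => none
  invFun := fun c => c.elim (inr 0) inl
  left_inv := by
    rintro (a | b)
    · rfl
    · exact congrArg inr (Subsingleton.elim _ _)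
  right_inv := by rintro (_ | a) <;> rfl

/-- Adding an empty summand. -/
def sumFinZeroEquiv (α : Type) : α ≃ α ⊕ Fin 0 where
  toFun := inl
  invFun := Sum.elim id fun i => i.elim0
  left_inv _ := rfl
  right_inv := by rintro (a | i) <;> [rfl; exact i.elim0]

theorem sumFinZeroEquiv_apply {α : Type} (a : α) : sumFinZeroEquiv α a = inl a := rfl

/-- Each copy of `K₂` is a row of kind `0` together with its own point. -/
theorem bipF_stdRows_add_K2_iso {α : Type} [Fintype α] (p o s : Bool) (τ : α → Fin 3) (m : ℕ) :
    (bipF (stdRows p o s τ) + m • K2).Iso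
      (bipF (stdRows p o s (Sum.elim τ fun _ : Fin m => 0))) := by
  refine ((Iso.refl _).add (smul_K2_iso_bip m)).trans ((bip_add_iso _ _).trans
    (bip_iso_of_equiv (Equiv.refl _) (optionSumEquiv _ _) ?_))
  rintro (a | i) ((_ | b) | j) <;>
    simp [sumRel, optionSumEquiv, none_mem_stdRows, some_mem_stdRows]

section

variable {α β : Type} [Fintype α] [Fintype β] {p o s : Bool} {d t : ℕ} {N : Matrix α β ℤ}

theorem ofBipartite_add_K2_iso (e : α ≃ Fin d ⊕ Fin t) (f : β ≃ Option (Fin d ⊕ Fin t))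
    (h : ∀ a b, f b ∈ stdRows p o s (Sum.elim (fun _ => 2) fun _ => 1) (e a) ↔ N a b = 1) (m : ℕ) :
    (ofBipartite N + m • K2).Iso (stdG p o s d t m) :=
  (((ofBipartite_iso_bip N).trans (bip_iso_of_equiv e f h)).add (Iso.refl _)).trans
    (bipF_stdRows_add_K2_iso p o s _ m)

theorem ofBipartite_add_K2_add_K1_iso (e : α ≃ Fin d ⊕ Fin t)
    (f : Option β ≃ Option (Fin d ⊕ Fin t))
    (h : ∀ a b, f (some b) ∈ stdRows p o s (Sum.elim (fun _ => 2) fun _ => 1) (e a) ↔ N a b = 1)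
    (hn : ∀ a, f none ∉ stdRows p o s (Sum.elim (fun _ => 2) fun _ => 1) (e a)) (m : ℕ) :
    (ofBipartite N + m • K2 + K1).Iso (stdG p o s d t m) := by
  refine (add_right_comm_iso _ _ _).trans (Iso.trans (Iso.add ?_ (Iso.refl _))
    (bipF_stdRows_add_K2_iso p o s _ m))
  refine ((ofBipartite_iso_bip N).add K1_iso_bip).trans ((bip_add_iso _ _).trans
    (bip_iso_of_equiv ((Equiv.sumEmpty _ _).trans e) ((sumFinOneEquiv _).trans f) ?_))
  rintro (a | i) (b | j)
  · simpa [sumRel, sumFinOneEquiv] using h a b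
  · simpa [sumRel, sumFinOneEquiv] using hn a
  · exact i.elim0
  · exact i.elim0

end

theorem graphL_iso (n m : ℕ) : (graphL n + m • K2 + K1).Iso (stdG true false false n 0 m) := by
  refine ofBipartite_add_K2_add_K1_iso (sumFinZeroEquiv _)
    (Equiv.optionCongr (sumFinZeroEquiv _)) (fun a b => ?_) (fun a => ?_) m
  · by_cases hab : a = b
    · simp [some_mem_stdRows, sumFinZeroEquiv_apply, JsubI, J, hab]
    · simp [some_mem_stdRows, sumFinZeroEquiv_apply, JsubI, J, hab, Ne.symm hab]
  · simp [none_mem_stdRows, sumFinZeroEquiv_apply]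

theorem graphH_iso (n m : ℕ) : (graphH n + m • K2).Iso (stdG true false true n 0 m) := by
  refine ofBipartite_add_K2_iso (sumFinZeroEquiv _)
    ((sumFinOneEquiv _).trans (Equiv.optionCongr (sumFinZeroEquiv _))) ?_ m
  rintro a (b | b)
  · by_cases hab : a = b
    · simp [some_mem_stdRows, sumFinOneEquiv, sumFinZeroEquiv_apply, JsubI, J, hab]
    · simp [some_mem_stdRows, sumFinOneEquiv, sumFinZeroEquiv_apply, JsubI, J, hab, Ne.symm hab]
  · simp [none_mem_stdRows, sumFinOneEquiv, sumFinZeroEquiv_apply, J]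

theorem graphR_iso (d m : ℕ) : (graphR (d + 3) + m • K2).Iso (stdG true true true d 3 m) := by
  refine ofBipartite_add_K2_iso (α := Fin d ⊕ Fin 3) (β := Fin d ⊕ (Fin 3 ⊕ Fin 1)) (Equiv.refl _)
    ((Equiv.sumAssoc _ _ _).symm.trans (sumFinOneEquiv _)) ?_ m
  rintro (a | a) (b | b | b) <;>
    simp [some_mem_stdRows, none_mem_stdRows, sumFinOneEquiv, J, extI, Matrix.one_apply, eq_comm]

theorem graphQ_iso (d m : ℕ) : (graphQ (d + 3) + m • K2).Iso (stdG false true true d 3 m) := by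
  refine ofBipartite_add_K2_iso (α := Fin d ⊕ Fin 3) (β := (Fin d ⊕ Fin 1) ⊕ Fin 3) (Equiv.refl _)
    -- The all-ones column of `extI d` is moved to the end, where it becomes the point `none`.
    ((Equiv.sumAssoc _ _ _).trans (((Equiv.refl _).sumCongr (Equiv.sumComm _ _)).trans
      ((Equiv.sumAssoc _ _ _).symm.trans (sumFinOneEquiv _)))) ?_ m
  rintro (a | a) ((b | b) | b)
  · simp [some_mem_stdRows, sumFinOneEquiv, extI, Matrix.one_apply, eq_comm]
  · simp [none_mem_stdRows, sumFinOneEquiv, J, extI]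
  · simp [some_mem_stdRows, sumFinOneEquiv, J]
  · simp [some_mem_stdRows, sumFinOneEquiv]
  · simp [none_mem_stdRows, sumFinOneEquiv]
  · by_cases hab : a = b
    · simp [some_mem_stdRows, sumFinOneEquiv, JsubI, J, hab]
    · simp [some_mem_stdRows, sumFinOneEquiv, JsubI, J, hab, Ne.symm hab]

theorem graphG1_iso (m : ℕ) : (graphG1 + m • K2 + K1).Iso (stdG true false true 1 4 m) := by
  refine ofBipartite_add_K2_add_K1_iso (Equiv.refl _)
    -- The first column of `G₁` is the common point `none` of the standard family, and the isolated
    -- vertex is the unused own point of the row of kind `2`.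
    (Equiv.swap none (some (inl 0))) ?_ ?_ m
  · rintro (a | a) (b | b)
    · obtain rfl := Subsingleton.elim b 0
      simp [none_mem_stdRows, J]
    · simp [some_mem_stdRows, J, Equiv.swap_apply_of_ne_of_ne]
    · obtain rfl := Subsingleton.elim b 0
      simp [none_mem_stdRows, J]
    · simp [some_mem_stdRows, Equiv.swap_apply_of_ne_of_ne, Matrix.one_apply, eq_comm]
  · rintro (a | a)
    · obtain rfl := Subsingleton.elim a 0
      simp [some_mem_stdRows]
    · simp [some_mem_stdRows]

theorem graphG2_iso (m : ℕ) : (graphG2 + m • K2 + K1).Iso (stdG false false false 3 3 m) := by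
  refine ofBipartite_add_K2_add_K1_iso (Equiv.refl _) (Equiv.refl _) ?_ ?_ m
  · rintro (a | a) (b | b)
    · by_cases hab : a = b
      · simp [some_mem_stdRows, JsubI, J, hab]
      · simp [some_mem_stdRows, JsubI, J, hab, Ne.symm hab]
    · simp [some_mem_stdRows, J]
    · simp [some_mem_stdRows]
    · by_cases hab : a = b
      · simp [some_mem_stdRows, JsubI, J, hab]
      · simp [some_mem_stdRows, JsubI, J, hab, Ne.symm hab]
  · rintro (a | a) <;> simp [none_mem_stdRows]

theorem graphG3_iso (m : ℕ) : (graphG3 + m • K2).Iso (stdG true false true 4 1 m) := by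
  refine ofBipartite_add_K2_iso (Equiv.refl _)
    -- Of the two all-ones columns, the first is the own point of the row of kind `1` and the second
    -- is `none`.
    (((Equiv.refl _).sumCongr (finSumFinEquiv (m := 1) (n := 1)).symm).trans
      ((Equiv.sumAssoc _ _ _).symm.trans (sumFinOneEquiv _))) ?_ m
  rintro a (b | b)
  · rcases a with a | a
    · by_cases hab : a = b
      · simp [some_mem_stdRows, sumFinOneEquiv, JsubI, J, hab]
      · simp [some_mem_stdRows, sumFinOneEquiv, JsubI, J, hab, Ne.symm hab]
    · simp [some_mem_stdRows, sumFinOneEquiv]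
  · obtain ⟨b, rfl⟩ := (finSumFinEquiv (m := 1) (n := 1)).surjective b
    rcases a with a | a <;> rcases b with b | b <;> obtain rfl := Subsingleton.elim b 0 <;>
      simp [some_mem_stdRows, none_mem_stdRows, sumFinOneEquiv, J]
    exact Subsingleton.elim _ _

theorem graphG4_iso (m : ℕ) : (graphG4 + m • K2).Iso (stdG true false true 3 2 m) := by
  refine ofBipartite_add_K2_iso (Equiv.refl _)
    ((Equiv.sumAssoc _ _ _).symm.trans (sumFinOneEquiv _)) ?_ m
  rintro (a | a) (b | b | b)
  · by_cases hab : a = b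
    · simp [some_mem_stdRows, sumFinOneEquiv, JsubI, J, hab]
    · simp [some_mem_stdRows, sumFinOneEquiv, JsubI, J, hab, Ne.symm hab]
  all_goals
    simp [some_mem_stdRows, none_mem_stdRows, sumFinOneEquiv, J, extI, Matrix.one_apply, eq_comm]

theorem graphS_iso_stdG (k : ℕ) : (graphS k).Iso (stdG true true true 0 k 0) := by
  have h : starRows k = stdRows true true true (fun _ => 1) := by
    ext a (_ | b)
    · simp [starRows, none_mem_stdRows]
    · simp [starRows, some_mem_stdRows]
  refine (graphS_iso_bipF k).trans ?_
  rw [h]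
  exact bipF_stdRows_iso_stdG _ _ _ (by simp) (by simp) (by simp)


open Finset

/-! ### Isomorphism invariants -/

/-- The degree of a vertex. -/
noncomputable def deg (A : FinGraph) (v : A.V) : ℕ := (A.graph.neighborSet v).ncard

/-- The graph has an isolated vertex. -/
def HasIsolated (A : FinGraph) : Prop := ∃ v, ∀ w, ¬ A.graph.Adj v w

/-- The graph has a component with two vertices. -/
def HasK2 (A : FinGraph) : Prop :=
  ∃ u v, A.graph.Adj u v ∧ (∀ w, A.graph.Adj u w → w = v) ∧ ∀ w, A.graph.Adj v w → w = u

/-- The graph has two adjacent vertices with the given degrees. -/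
def HasDegPair (A : FinGraph) (x y : ℕ) : Prop :=
  ∃ u v, A.graph.Adj u v ∧ A.deg u = x ∧ A.deg v = y

theorem deg_iso {A B : FinGraph} (e : A.graph ≃g B.graph) (v : A.V) : B.deg (e v) = A.deg v := by
  unfold deg
  rw [← Set.ncard_image_of_injective _ e.injective]
  congr 1
  ext w
  simp only [SimpleGraph.mem_neighborSet, Set.mem_image]
  constructor
  · intro h
    exact ⟨e.symm w, by simpa using e.symm.map_adj_iff.mpr h, by simp⟩
  · rintro ⟨x, hx, rfl⟩
    exact e.map_adj_iff.mpr hx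

theorem HasIsolated.of_iso {A B : FinGraph} (h : A.Iso B) (hA : A.HasIsolated) :
    B.HasIsolated := by
  obtain ⟨e⟩ := h
  obtain ⟨v, hv⟩ := hA
  refine ⟨e v, fun w hw => hv (e.symm w) ?_⟩
  simpa using e.symm.map_adj_iff.mpr hw

theorem HasK2.of_iso {A B : FinGraph} (h : A.Iso B) (hA : A.HasK2) : B.HasK2 := by
  obtain ⟨e⟩ := h
  obtain ⟨u, v, huv, hu, hv⟩ := hA
  refine ⟨e u, e v, e.map_adj_iff.mpr huv, fun w hw => ?_, fun w hw => ?_⟩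
  · rw [← hu (e.symm w) (by simpa using e.symm.map_adj_iff.mpr hw)]; simp
  · rw [← hv (e.symm w) (by simpa using e.symm.map_adj_iff.mpr hw)]; simp

theorem HasDegPair.of_iso {A B : FinGraph} {x y : ℕ} (h : A.Iso B) (hA : A.HasDegPair x y) :
    B.HasDegPair x y := by
  obtain ⟨e⟩ := h
  obtain ⟨u, v, huv, hu, hv⟩ := hA
  exact ⟨e u, e v, e.map_adj_iff.mpr huv, (deg_iso e u).trans hu, (deg_iso e v).trans hv⟩

section

variable {α β : Type} [Fintype α] [Fintype β]

theorem deg_bipF_inl (r : α → Finset β) (a : α) :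
    (bipF r).deg (Sum.inl a : α ⊕ β) = #(r a) := by
  have : (bipGraph fun a b => b ∈ r a).neighborSet (Sum.inl a) =
      (Sum.inr '' (r a : Set β) : Set (α ⊕ β)) := by
    ext (x | x)
    · exact iff_of_false id (by rintro ⟨y, -, hy⟩; cases hy)
    · constructor
      · intro h; exact ⟨x, h, rfl⟩
      · rintro ⟨y, hy, h⟩; cases h; exact hy
  change ((bipGraph fun a b => b ∈ r a).neighborSet _).ncard = _
  rw [this, Set.ncard_image_of_injective _ Sum.inr_injective, Set.ncard_coe_finset]

theorem deg_bipF_inr [DecidableEq β] (r : α → Finset β) (b : β) :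
    (bipF r).deg (Sum.inr b : α ⊕ β) = #{a | b ∈ r a} := by
  have : (bipGraph fun a b => b ∈ r a).neighborSet (Sum.inr b) =
      (Sum.inl '' (({a | b ∈ r a} : Finset α) : Set α) : Set (α ⊕ β)) := by
    ext (x | x)
    · constructor
      · intro h; exact ⟨x, mem_coe.mpr (mem_filter.mpr ⟨mem_univ _, h⟩), rfl⟩
      · rintro ⟨y, hy, h⟩; cases h; exact (mem_filter.mp (mem_coe.mp hy)).2
    · exact iff_of_false id (by rintro ⟨y, -, hy⟩; cases hy)
  change ((bipGraph fun a b => b ∈ r a).neighborSet _).ncard = _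
  rw [this, Set.ncard_image_of_injective _ Sum.inl_injective, Set.ncard_coe_finset]

variable [DecidableEq α] {p o s : Bool} {τ : α → Fin 3}

theorem card_col_none : #{a | none ∈ stdRows p o s τ a} =
    (if p then #{a | τ a = 1} else 0) + if s then #{a | τ a = 2} else 0 := by
  cases p <;> cases s <;> simp [none_mem_stdRows, filter_or]
  rw [card_union_of_disjoint]
  rw [disjoint_left]; intro a; simp +contextual

theorem card_col_zero {b : α} (hb : τ b = 0) : #{a | some b ∈ stdRows p o s τ a} = 1 := by
  rw [card_eq_one]
  refine ⟨b, ?_⟩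
  ext a
  simp only [mem_filter, mem_univ, true_and, mem_singleton, some_mem_stdRows, hb]
  by_cases hab : a = b
  · subst hab; simp [hb]
  · simp [hab, Ne.symm hab]

theorem card_col_one {b : α} (hb : τ b = 1) : #{a | some b ∈ stdRows p o s τ a} =
    (if p then 1 else #{a | τ a = 1} - 1) + #{a | τ a = 2} := by
  have h1 : ({a | some b ∈ stdRows p o s τ a} : Finset α) =
      (if p then {b} else ({a | τ a = 1} : Finset α).erase b) ∪
        ({a | τ a = 2} : Finset α) := by
    ext a
    by_cases hab : a = b
    · subst hab; cases p <;> simp [some_mem_stdRows, hb]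
    · cases p <;> simp [some_mem_stdRows, hb, hab, Ne.symm hab]
  have h2 : Disjoint (if p then {b} else ({a | τ a = 1} : Finset α).erase b)
      ({a | τ a = 2} : Finset α) := by
    cases p
    · rw [disjoint_left]; intro a; simp +contextual
    · simp [hb]
  rw [h1, card_union_of_disjoint h2]
  congr 1
  cases p
  · simp [card_erase_of_mem, hb]
  · simp

theorem card_col_two {b : α} (hb : τ b = 2) : #{a | some b ∈ stdRows p o s τ a} =
    if o then 1 else #{a | τ a = 2} - 1 := by
  have h1 : ({a | some b ∈ stdRows p o s τ a} : Finset α) =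
      if o then {b} else ({a | τ a = 2} : Finset α).erase b := by
    ext a
    by_cases hab : a = b
    · subst hab; cases o <;> simp [some_mem_stdRows, hb]
    · cases o <;> simp [some_mem_stdRows, hb, hab, Ne.symm hab]
  rw [h1]
  cases o
  · simp [card_erase_of_mem, hb]
  · simp

end


/-! ### Invariants that separate the listed graphs -/

open Finset

section

variable {α β : Type} [Fintype α] [Fintype β] (r : α → Finset β)

theorem hasK2_bipF {a : α} {b : β} (ha : r a = {b}) (hb : ∀ a', b ∈ r a' → a' = a) :
    (bipF r).HasK2 := by
  refine ⟨Sum.inl a, Sum.inr b, ?_, ?_, ?_⟩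
  · change b ∈ r a
    simp [ha]
  · rintro (w | w) hw
    · exact hw.elim
    · have hw' : w ∈ r a := hw
      rw [ha, mem_singleton] at hw'
      rw [hw']
  · rintro (w | w) hw
    · rw [hb w hw]
    · exact hw.elim

theorem hasIsolated_bipF {b : β} (hb : ∀ a, b ∉ r a) : (bipF r).HasIsolated := by
  refine ⟨Sum.inr b, ?_⟩
  rintro (w | w) hw
  · exact hb w hw
  · exact hw

theorem not_hasIsolated_bipF (ha : ∀ a, (r a).Nonempty) (hb : ∀ b, ∃ a, b ∈ r a) :
    ¬ (bipF r).HasIsolated := by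
  rintro ⟨v | v, hv⟩
  · obtain ⟨b, hb⟩ := ha v
    exact hv (Sum.inr b) hb
  · obtain ⟨a, ha⟩ := hb v
    exact hv (Sum.inl a) ha

theorem not_hasK2_bipF (ha : ∀ a, 1 < #(r a)) : ¬ (bipF r).HasK2 := by
  have key : ∀ a b, ¬ ∀ w : α ⊕ β, bipAdj (fun a b => b ∈ r a) (Sum.inl a) w → w = Sum.inr b := by
    intro a b h
    obtain ⟨x, hx, y, hy, hxy⟩ := one_lt_card.mp (ha a)
    have h1 := h (Sum.inr x) hx
    have h2 := h (Sum.inr y) hy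
    exact hxy (Sum.inr_injective (h1.trans h2.symm))
  rintro ⟨u | u, v | v, huv, hu, hv⟩
  · exact huv
  · exact key u v hu
  · exact key v u hv
  · exact huv

theorem hasDegPair_bipF_iff [DecidableEq β] (x y : ℕ) : (bipF r).HasDegPair x y ↔
    ∃ a b, b ∈ r a ∧ ((#(r a) = x ∧ #{a | b ∈ r a} = y) ∨ (#(r a) = y ∧ #{a | b ∈ r a} = x)) := by
  constructor
  · rintro ⟨u | u, v | v, huv, hu, hv⟩
    · exact huv.elim
    · exact ⟨u, v, huv, Or.inl ⟨(deg_bipF_inl r u).symm.trans hu, (deg_bipF_inr r v).symm.trans hv⟩⟩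
    · exact ⟨v, u, huv, Or.inr ⟨(deg_bipF_inl r v).symm.trans hv, (deg_bipF_inr r u).symm.trans hu⟩⟩
    · exact huv.elim
  · rintro ⟨a, b, hab, ⟨h1, h2⟩ | ⟨h1, h2⟩⟩
    · exact ⟨Sum.inl a, Sum.inr b, hab, (deg_bipF_inl r a).trans h1, (deg_bipF_inr r b).trans h2⟩
    · exact ⟨Sum.inr b, Sum.inl a, hab, (deg_bipF_inr r b).trans h2, (deg_bipF_inl r a).trans h1⟩

end

theorem not_hasIsolated_graphS {k : ℕ} (hk : 1 ≤ k) : ¬ (graphS k).HasIsolated := fun h =>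
  not_hasIsolated_bipF (starRows k) (fun a => by simp [starRows])
    (by rintro (_ | b)
        · exact ⟨⟨0, hk⟩, by simp [starRows]⟩
        · exact ⟨b, by simp [starRows]⟩) (h.of_iso (graphS_iso_bipF k))

theorem not_hasK2_graphS (k : ℕ) : ¬ (graphS k).HasK2 := fun h =>
  not_hasK2_bipF (starRows k) (fun a => by simp [starRows]) (h.of_iso (graphS_iso_bipF k))

theorem hasK2_stdG (p o s : Bool) (d t : ℕ) {z : ℕ} (hz : 1 ≤ z) : (stdG p o s d t z).HasK2 := by
  refine hasK2_bipF _ (a := Sum.inr ⟨0, hz⟩) (b := some (Sum.inr ⟨0, hz⟩)) ?_ ?_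
  · ext (_ | ((b | b) | b)) <;> simp [none_mem_stdRows, some_mem_stdRows, kind]
  · rintro ((a | a) | a) <;> simp [some_mem_stdRows, kind, eq_comm]

theorem hasIsolated_stdG_L (n z : ℕ) : (stdG true false false n 0 z).HasIsolated := by
  refine hasIsolated_bipF _ (b := none) ?_
  rintro ((a | a) | a)
  · simp [none_mem_stdRows, kind]
  · exact a.elim0
  · simp [none_mem_stdRows, kind]


theorem hasIsolated_stdG_G2 (z : ℕ) : (stdG false false false 3 3 z).HasIsolated := by
  refine hasIsolated_bipF _ (b := none) ?_
  rintro ((a | a) | a) <;> simp [none_mem_stdRows, kind]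

theorem not_hasIsolated_stdG (p : Bool) {d : ℕ} (hd : 1 ≤ d) (z : ℕ) :
    ¬ (stdG p true true d 3 z).HasIsolated := by
  refine not_hasIsolated_bipF _ (fun a => ?_) ?_
  · rcases a with (a | a) | a
    · exact ⟨none, by simp [none_mem_stdRows, kind]⟩
    · cases p
      · exact ⟨some (Sum.inl (Sum.inr (a + 1))), by simp [some_mem_stdRows, kind]⟩
      · exact ⟨none, by simp [none_mem_stdRows, kind]⟩
    · exact ⟨some (Sum.inr a), by simp [some_mem_stdRows, kind]⟩
  · rintro (_ | ((b | b) | b))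
    · exact ⟨Sum.inl (Sum.inl ⟨0, hd⟩), by simp [none_mem_stdRows, kind]⟩
    · exact ⟨Sum.inl (Sum.inl b), by simp [some_mem_stdRows, kind]⟩
    · exact ⟨Sum.inl (Sum.inl ⟨0, hd⟩), by simp [some_mem_stdRows, kind]⟩
    · exact ⟨Sum.inr b, by simp [some_mem_stdRows, kind]⟩

/-- A point of the triangle lies in two `2`-rows and in all `d` rows of size `5`. -/
theorem hasDegPair_stdG_Q (d z : ℕ) : (stdG false true true d 3 z).HasDegPair (d + 2) 2 := by
  refine (hasDegPair_bipF_iff _ _ _).mpr ⟨Sum.inl (Sum.inr 0), some (Sum.inl (Sum.inr 1)), ?_,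
    Or.inr ⟨?_, ?_⟩⟩
  · simp [some_mem_stdRows, kind]
  · rw [card_stdRows_one (by simp [kind]), card_kind_one]; simp
  · rw [card_col_one (by simp [kind]), card_kind_one, card_kind_two]; simp; omega

/-- The points have degrees `1`, `d + 1`, `d + 3` and the rows `1`, `2`, `5`. So degree `d + 2`
occurs only for `d = 3`, on a `5`-row, and then no point has degree `2`. Because of `d = 3` a pair
of degrees is needed rather than one degree. -/
theorem not_hasDegPair_stdG_R {d : ℕ} (hd : 1 ≤ d) (z : ℕ) :
    ¬ (stdG true true true d 3 z).HasDegPair (d + 2) 2 := by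
  intro h
  obtain ⟨a, b, hab, hdeg⟩ := (hasDegPair_bipF_iff _ _ _).mp h
  have hr := kind_cases (kind d 3 z a)
  have hr0 := card_stdRows_zero (p := true) (o := true) (s := true) (τ := kind d 3 z) (a := a)
  have hr1 := card_stdRows_one (p := true) (o := true) (s := true) (τ := kind d 3 z) (a := a)
  have hr2 := card_stdRows_two (p := true) (o := true) (s := true) (τ := kind d 3 z) (a := a)
  rcases b with _ | b
  · have hc := card_col_none (p := true) (o := true) (s := true) (τ := kind d 3 z)
    simp only [if_true, card_kind_one, card_kind_two] at *
    omega
  · have hc := kind_cases (kind d 3 z b)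
    have hc0 := card_col_zero (p := true) (o := true) (s := true) (τ := kind d 3 z) (b := b)
    have hc1 := card_col_one (p := true) (o := true) (s := true) (τ := kind d 3 z) (b := b)
    have hc2 := card_col_two (p := true) (o := true) (s := true) (τ := kind d 3 z) (b := b)
    simp only [if_true, card_kind_one, card_kind_two] at *
    omega

/-- For `n ≤ 5` no vertex of `L_{n,n}` has degree `5`. -/
theorem not_hasDegPair_stdG_L {n y : ℕ} (hn : n ≤ 5) (z : ℕ) :
    ¬ (stdG true false false n 0 z).HasDegPair 5 y := by
  intro h
  obtain ⟨a, b, hab, hdeg⟩ := (hasDegPair_bipF_iff _ _ _).mp h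
  have ht : ∀ c, kind n 0 z c = 1 → False := fun c hc => by
    have := card_kind_one n 0 z
    rw [card_eq_zero, filter_eq_empty_iff] at this
    exact this (mem_univ c) hc
  have hr := kind_cases (kind n 0 z a)
  have hr0 := card_stdRows_zero (p := true) (o := false) (s := false) (τ := kind n 0 z) (a := a)
  have hr2 := card_stdRows_two (p := true) (o := false) (s := false) (τ := kind n 0 z) (a := a)
  rcases b with _ | b
  · rw [none_mem_stdRows] at hab
    exact ht a (by simpa using hab)
  · have hc := kind_cases (kind n 0 z b)
    have hc0 := card_col_zero (p := true) (o := false) (s := false) (τ := kind n 0 z) (b := b)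
    have hc2 := card_col_two (p := true) (o := false) (s := false) (τ := kind n 0 z) (b := b)
    simp only [Bool.false_eq_true, if_false, card_kind_one, card_kind_two] at hr2 hc2
    have hr' : #(stdRows true false false (kind n 0 z) a) < 5 := by
      rcases hr with hr | hr | hr
      · rw [hr0 hr]; omega
      · exact (ht a hr).elim
      · rw [hr2 hr]; omega
    have hc' : #{a | some b ∈ stdRows true false false (kind n 0 z) a} < 5 := by
      rcases hc with hc | hc | hc
      · rw [hc0 hc]; omega
      · exact (ht b hc).elim
      · rw [hc2 hc]; omega
    rcases hdeg with hdeg | hdeg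
    · exact hr'.ne hdeg.1
    · exact hc'.ne hdeg.2

theorem hasDegPair_stdG_G1 (z : ℕ) : (stdG true false true 1 4 z).HasDegPair 5 2 := by
  refine (hasDegPair_bipF_iff _ _ _).mpr ⟨Sum.inl (Sum.inl 0), some (Sum.inl (Sum.inr 0)), ?_,
    Or.inl ⟨?_, ?_⟩⟩
  · simp [some_mem_stdRows, kind]
  · rw [card_stdRows_two (by simp [kind]), card_kind_one, card_kind_two]; simp
  · rw [card_col_one (by simp [kind]), card_kind_one, card_kind_two]; simp

theorem hasDegPair_stdG_G2 (z : ℕ) : (stdG false false false 3 3 z).HasDegPair 5 5 := by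
  refine (hasDegPair_bipF_iff _ _ _).mpr ⟨Sum.inl (Sum.inl 0), some (Sum.inl (Sum.inr 0)), ?_,
    Or.inl ⟨?_, ?_⟩⟩
  · simp [some_mem_stdRows, kind]
  · rw [card_stdRows_two (by simp [kind]), card_kind_one, card_kind_two]; simp
  · rw [card_col_one (by simp [kind]), card_kind_one, card_kind_two]; simp


/-! ### The cospectral mates of the subdivided stars -/

/-- The subdivided star has neither isolated vertices nor `K₂` components. The second alternative is
needed for `L_{3,3} ∪ K₁`, which has no `K₂` component. -/
theorem isMate_of_iso_stdG {B : FinGraph} {p o s : Bool} {d t z k : ℕ} (hk : 1 ≤ k)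
    (hp : StdParam p o s t d k) (hz : d + t + z = k) (hB : B.Iso (stdG p o s d t z))
    (h : 1 ≤ z ∨ (stdG p o s d t z).HasIsolated) : B.IsMate (graphS k) := by
  refine ⟨(spec_eq_graphS_iff_stdG hk B).mpr ⟨p, o, s, d, t, z, hp, hz, hB⟩, fun hS => ?_⟩
  have hiso := hB.symm.trans hS
  rcases h with h | h
  · exact not_hasK2_graphS k ((hasK2_stdG p o s d t h).of_iso hiso)
  · exact not_hasIsolated_graphS hk (h.of_iso hiso)

theorem isMate_graphL {n : ℕ} (hn : 1 ≤ n) :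
    (graphL (n + 2) + (n * (n + 2) - (n + 2)) • K2 + K1).IsMate (graphS (n * (n + 2))) :=
  isMate_of_iso_stdG (Nat.mul_pos hn (by omega)) (StdParam.L n hn)
    (by have := Nat.le_mul_of_pos_left (n + 2) hn; omega) (graphL_iso _ _)
    (Or.inr (hasIsolated_stdG_L _ _))

theorem isMate_graphH {n : ℕ} (hn : 2 ≤ n) :
    (graphH (n + 1) + (n * (n + 1) - (n + 1)) • K2).IsMate (graphS (n * (n + 1))) := by
  have : 2 * (n + 1) ≤ n * (n + 1) := Nat.mul_le_mul_right _ hn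
  exact isMate_of_iso_stdG (by omega) (StdParam.H n hn) (by omega) (graphH_iso _ _)
    (Or.inl (by omega))

theorem isMate_graphR {d : ℕ} (hd : 1 ≤ d) :
    (graphR (d + 3) + (3 * d) • K2).IsMate (graphS (4 * d + 3)) :=
  isMate_of_iso_stdG (by omega) (StdParam.R d hd) (by omega) (graphR_iso _ _) (Or.inl (by omega))

theorem isMate_graphQ {d : ℕ} (hd : 1 ≤ d) :
    (graphQ (d + 3) + (3 * d) • K2).IsMate (graphS (4 * d + 3)) :=
  isMate_of_iso_stdG (by omega) (StdParam.Q d hd) (by omega) (graphQ_iso _ _) (Or.inl (by omega))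

theorem isMate_graphG1 : (graphG1 + 3 • K2 + K1).IsMate (graphS 8) :=
  isMate_of_iso_stdG (by omega) StdParam.G1 (by omega) (graphG1_iso _) (Or.inl (by omega))

theorem isMate_graphG2 : (graphG2 + 9 • K2 + K1).IsMate (graphS 15) :=
  isMate_of_iso_stdG (by omega) StdParam.G2 (by omega) (graphG2_iso _) (Or.inl (by omega))

theorem isMate_graphG3 : (graphG3 + 12 • K2).IsMate (graphS 17) :=
  isMate_of_iso_stdG (by omega) StdParam.G3 (by omega) (graphG3_iso _) (Or.inl (by omega))

theorem isMate_graphG4 : (graphG4 + 9 • K2).IsMate (graphS 14) :=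
  isMate_of_iso_stdG (by omega) StdParam.G4 (by omega) (graphG4_iso _) (Or.inl (by omega))

theorem IsMate.of_iso {A B C : FinGraph} (h : B.Iso C) (hC : C.IsMate A) : B.IsMate A :=
  ⟨(spec_eq_of_iso h).trans hC.1, fun hB => hC.2 (h.symm.trans hB)⟩

/-- Every cospectral mate of a subdivided star is one of the listed graphs. -/
theorem IsMate.cases {k : ℕ} (hk : 1 ≤ k) {B : FinGraph} (h : B.IsMate (graphS k)) :
    (∃ n, 1 ≤ n ∧ k = n * (n + 2) ∧ B.Iso (graphL (n + 2) + (k - (n + 2)) • K2 + K1)) ∨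
    (∃ n, 2 ≤ n ∧ k = n * (n + 1) ∧ B.Iso (graphH (n + 1) + (k - (n + 1)) • K2)) ∨
    (∃ d, 1 ≤ d ∧ k = 4 * d + 3 ∧ (B.Iso (graphR (d + 3) + (3 * d) • K2) ∨
      B.Iso (graphQ (d + 3) + (3 * d) • K2))) ∨
    (k = 8 ∧ B.Iso (graphG1 + 3 • K2 + K1)) ∨ (k = 15 ∧ B.Iso (graphG2 + 9 • K2 + K1)) ∨
    (k = 17 ∧ B.Iso (graphG3 + 12 • K2)) ∨ (k = 14 ∧ B.Iso (graphG4 + 9 • K2)) := by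
  obtain ⟨p, o, s, d, t, z, hp, hz, hB⟩ := (spec_eq_graphS_iff_stdG hk B).mp h.1
  cases hp with
  | star =>
    obtain rfl : z = 0 := by omega
    exact absurd (hB.trans (graphS_iso_stdG k).symm) h.2
  | L n hn =>
    refine Or.inl ⟨n, hn, rfl, ?_⟩
    obtain rfl : z = n * (n + 2) - (n + 2) := by omega
    exact hB.trans (graphL_iso _ _).symm
  | H n hn =>
    refine Or.inr (Or.inl ⟨n, hn, rfl, ?_⟩)
    obtain rfl : z = n * (n + 1) - (n + 1) := by omega
    exact hB.trans (graphH_iso _ _).symm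
  | R _ hd =>
    refine Or.inr (Or.inr (Or.inl ⟨d, hd, rfl, Or.inl ?_⟩))
    obtain rfl : z = 3 * d := by omega
    exact hB.trans (graphR_iso _ _).symm
  | Q _ hd =>
    refine Or.inr (Or.inr (Or.inl ⟨d, hd, rfl, Or.inr ?_⟩))
    obtain rfl : z = 3 * d := by omega
    exact hB.trans (graphQ_iso _ _).symm
  | G1 =>
    obtain rfl : z = 3 := by omega
    exact Or.inr (Or.inr (Or.inr (Or.inl ⟨rfl, hB.trans (graphG1_iso _).symm⟩)))
  | G2 =>
    obtain rfl : z = 9 := by omega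
    exact Or.inr (Or.inr (Or.inr (Or.inr (Or.inl ⟨rfl, hB.trans (graphG2_iso _).symm⟩))))
  | G3 =>
    obtain rfl : z = 12 := by omega
    exact Or.inr (Or.inr (Or.inr (Or.inr (Or.inr (Or.inl ⟨rfl, hB.trans (graphG3_iso _).symm⟩)))))
  | G4 =>
    obtain rfl : z = 9 := by omega
    exact Or.inr (Or.inr (Or.inr (Or.inr (Or.inr (Or.inr ⟨rfl, hB.trans (graphG4_iso _).symm⟩)))))

theorem isDS_iff_forall_not_isMate (A : FinGraph) : A.IsDS ↔ ∀ B : FinGraph, ¬ B.IsMate A := by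
  simp [IsDS, IsMate]

theorem hasExactlyMates_of {A : FinGraph} {L : List FinGraph}
    (h1 : L.Pairwise fun B C => ¬ B.Iso C) (h2 : ∀ C ∈ L, C.IsMate A)
    (h3 : ∀ B : FinGraph, B.IsMate A → ∃ C ∈ L, B.Iso C) : A.HasExactlyMates L :=
  ⟨h1, fun B => ⟨h3 B, fun ⟨C, hC, hBC⟩ => (h2 C hC).of_iso hBC⟩⟩

/-! ### The listed mates are pairwise non-isomorphic -/

theorem not_iso_graphR_graphQ {d : ℕ} (hd : 1 ≤ d) (m : ℕ) :
    ¬ (graphR (d + 3) + m • K2).Iso (graphQ (d + 3) + m • K2) := fun h =>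
  not_hasDegPair_stdG_R hd m ((hasDegPair_stdG_Q d m).of_iso
    ((graphQ_iso d m).symm.trans (h.symm.trans (graphR_iso d m))))

theorem not_iso_graphR_of_hasIsolated {A : FinGraph} (hA : A.HasIsolated) {d : ℕ} (hd : 1 ≤ d)
    (m : ℕ) : ¬ A.Iso (graphR (d + 3) + m • K2) := fun h =>
  not_hasIsolated_stdG true hd m (hA.of_iso (h.trans (graphR_iso d m)))

theorem not_iso_graphQ_of_hasIsolated {A : FinGraph} (hA : A.HasIsolated) {d : ℕ} (hd : 1 ≤ d)
    (m : ℕ) : ¬ A.Iso (graphQ (d + 3) + m • K2) := fun h =>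
  not_hasIsolated_stdG false hd m (hA.of_iso (h.trans (graphQ_iso d m)))

theorem hasIsolated_graphL (n m : ℕ) : (graphL n + m • K2 + K1).HasIsolated :=
  (hasIsolated_stdG_L n m).of_iso (graphL_iso n m).symm

theorem hasIsolated_graphG2 (m : ℕ) : (graphG2 + m • K2 + K1).HasIsolated :=
  (hasIsolated_stdG_G2 m).of_iso (graphG2_iso m).symm

theorem not_iso_graphL_graphG1 (m m' : ℕ) :
    ¬ (graphL 4 + m • K2 + K1).Iso (graphG1 + m' • K2 + K1) := fun h =>
  not_hasDegPair_stdG_L (by omega) m ((hasDegPair_stdG_G1 m').of_iso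
    ((graphG1_iso m').symm.trans (h.symm.trans (graphL_iso 4 m))))

theorem not_iso_graphG2_graphL (m m' : ℕ) :
    ¬ (graphG2 + m • K2 + K1).Iso (graphL 5 + m' • K2 + K1) := fun h =>
  not_hasDegPair_stdG_L (by omega) m' ((hasDegPair_stdG_G2 m).of_iso
    ((graphG2_iso m).symm.trans (h.trans (graphL_iso 5 m'))))

/-! ### Each case of the theorem -/

theorem isDS_graphS_iff {k : ℕ} (hk : 1 ≤ k) : (graphS k).IsDS ↔ k ∉ exceptionalSet := by
  rw [isDS_iff_forall_not_isMate]
  constructor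
  · intro h hS
    rcases hS with ((⟨l, rfl⟩ | ⟨l, hl, hkl⟩) | ⟨l, hl, hkl⟩) | (rfl | hk17)
    -- For `l = 0`, that is `k = 3`, the mate is `L_{3,3} ∪ K₁` since `R` needs `1 ≤ d`.
    · rcases Nat.eq_zero_or_pos l with rfl | hl
      · exact h _ (isMate_graphL (n := 1) le_rfl)
      · exact h _ (isMate_graphR hl)
    · obtain ⟨n, rfl⟩ : ∃ n, l = n + 1 := ⟨l - 1, by omega⟩
      have : k = n * (n + 2) := by rw [hkl]; ring_nf; omega
      subst this
      exact h _ (isMate_graphL (by omega))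
    · obtain ⟨n, rfl⟩ : ∃ n, l = n + 1 := ⟨l - 1, by omega⟩
      have : k = n * (n + 1) := by rw [hkl, sq, ← Nat.sub_one_mul]; rfl
      subst this
      exact h _ (isMate_graphH (by omega))
    · exact h _ isMate_graphG4
    · obtain rfl : k = 17 := hk17
      exact h _ isMate_graphG3
  · intro hS B hB
    refine hS ?_
    rcases hB.cases hk with ⟨n, hn, rfl, -⟩ | ⟨n, hn, rfl, -⟩ | ⟨d, hd, rfl, -⟩ | ⟨rfl, -⟩ |
      ⟨rfl, -⟩ | ⟨rfl, -⟩ | ⟨rfl, -⟩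
    · exact Or.inl (Or.inl (Or.inr ⟨n + 1, by omega, by ring_nf; omega⟩))
    · exact Or.inl (Or.inr ⟨n + 1, by omega, by rw [sq, ← Nat.sub_one_mul]; rfl⟩)
    · exact Or.inl (Or.inl (Or.inl ⟨d, rfl⟩))
    -- The values `8` and `15` of `G₁` and `G₂` are already of the form `l ^ 2 - 1`.
    · exact Or.inl (Or.inl (Or.inr ⟨3, by omega, rfl⟩))
    · exact Or.inl (Or.inl (Or.inr ⟨4, by omega, rfl⟩))
    · exact Or.inr (Or.inr rfl)
    · exact Or.inr (Or.inl rfl)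

theorem hasExactlyMates_three : (graphS 3).HasExactlyMates [graphL 3 + K1] := by
  have h0 : (graphL 3 + 0 • K2 + K1).Iso (graphL 3 + K1) :=
    (add_zero_smul_K2_iso _).add (Iso.refl _)
  refine hasExactlyMates_of (by simp) ?_ fun B hB => ?_
  · simpa using IsMate.of_iso h0.symm (isMate_graphL (n := 1) le_rfl)
  · refine ⟨_, List.mem_singleton_self _, ?_⟩
    rcases hB.cases (by omega) with ⟨n, hn, hk, h⟩ | ⟨n, hn, hk, h⟩ | ⟨d, hd, hk, h⟩ | ⟨hk, h⟩ |
      ⟨hk, h⟩ | ⟨hk, h⟩ | ⟨hk, h⟩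
    · obtain rfl : n = 1 := by nlinarith
      exact h.trans h0
    · nlinarith
    all_goals omega

theorem hasExactlyMates_eight : (graphS 8).HasExactlyMates
    [graphL 4 + 4 • K2 + K1, graphG1 + 3 • K2 + K1] := by
  refine hasExactlyMates_of ?_ ?_ fun B hB => ?_
  · simpa using not_iso_graphL_graphG1 4 3
  · simpa using ⟨isMate_graphL (n := 2) (by omega), isMate_graphG1⟩
  · rcases hB.cases (by omega) with ⟨n, hn, hk, h⟩ | ⟨n, hn, hk, h⟩ | ⟨d, hd, hk, h⟩ | ⟨hk, h⟩ |
      ⟨hk, h⟩ | ⟨hk, h⟩ | ⟨hk, h⟩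
    · obtain rfl : n = 2 := by nlinarith
      exact ⟨_, by simp, h⟩
    · have : n < 3 := by nlinarith
      interval_cases n; omega
    · omega
    · exact ⟨_, by simp, h⟩
    all_goals omega

theorem hasExactlyMates_fourteen : (graphS 14).HasExactlyMates [graphG4 + 9 • K2] := by
  refine hasExactlyMates_of (by simp) (by simpa using isMate_graphG4) fun B hB => ?_
  rcases hB.cases (by omega) with ⟨n, hn, hk, h⟩ | ⟨n, hn, hk, h⟩ | ⟨d, hd, hk, h⟩ | ⟨hk, h⟩ |
    ⟨hk, h⟩ | ⟨hk, h⟩ | ⟨hk, h⟩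
  · have : n < 4 := by nlinarith
    interval_cases n <;> omega
  · have : n < 4 := by nlinarith
    interval_cases n <;> omega
  any_goals omega
  exact ⟨_, by simp, h⟩

theorem hasExactlyMates_fifteen : (graphS 15).HasExactlyMates
    [graphG2 + 9 • K2 + K1, graphL 5 + 10 • K2 + K1, graphR 6 + 9 • K2, graphQ 6 + 9 • K2] := by
  refine hasExactlyMates_of ?_ ?_ fun B hB => ?_
  · simp only [List.pairwise_cons, List.mem_cons, List.not_mem_nil, or_false, forall_eq_or_imp,
      forall_eq, List.Pairwise.nil, and_true, false_imp_iff, implies_true]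
    exact ⟨⟨not_iso_graphG2_graphL 9 10,
      not_iso_graphR_of_hasIsolated (d := 3) (hasIsolated_graphG2 9) (by omega) 9,
      not_iso_graphQ_of_hasIsolated (d := 3) (hasIsolated_graphG2 9) (by omega) 9⟩,
      ⟨not_iso_graphR_of_hasIsolated (d := 3) (hasIsolated_graphL 5 10) (by omega) 9,
      not_iso_graphQ_of_hasIsolated (d := 3) (hasIsolated_graphL 5 10) (by omega) 9⟩,
      not_iso_graphR_graphQ (d := 3) (by omega) 9⟩
  · simpa using ⟨isMate_graphG2, isMate_graphL (n := 3) (by omega),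
      isMate_graphR (d := 3) (by omega), isMate_graphQ (d := 3) (by omega)⟩
  · rcases hB.cases (by omega) with ⟨n, hn, hk, h⟩ | ⟨n, hn, hk, h⟩ | ⟨d, hd, hk, h | h⟩ | ⟨hk, h⟩ |
      ⟨hk, h⟩ | ⟨hk, h⟩ | ⟨hk, h⟩
    · obtain rfl : n = 3 := by nlinarith
      exact ⟨_, by simp, h⟩
    · have : n < 4 := by nlinarith
      interval_cases n <;> omega
    · obtain rfl : d = 3 := by omega
      exact ⟨_, by simp, h⟩
    · obtain rfl : d = 3 := by omega
      exact ⟨_, by simp, h⟩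
    · omega
    · exact ⟨_, by simp, h⟩
    all_goals omega

theorem hasExactlyMates_seventeen : (graphS 17).HasExactlyMates [graphG3 + 12 • K2] := by
  refine hasExactlyMates_of (by simp) (by simpa using isMate_graphG3) fun B hB => ?_
  rcases hB.cases (by omega) with ⟨n, hn, hk, h⟩ | ⟨n, hn, hk, h⟩ | ⟨d, hd, hk, h⟩ | ⟨hk, h⟩ |
    ⟨hk, h⟩ | ⟨hk, h⟩ | ⟨hk, h⟩
  · have : n < 4 := by nlinarith
    interval_cases n <;> omega
  · have : n < 4 := by nlinarith
    interval_cases n <;> omega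
  any_goals omega
  exact ⟨_, by simp, h⟩

theorem hasExactlyMates_four_mul_add_three {l : ℕ} (hl : ¬ ∃ t : ℤ, (l : ℤ) = t ^ 2 - 1) :
    (graphS (4 * l + 3)).HasExactlyMates
      [graphR (l + 3) + (3 * l) • K2, graphQ (l + 3) + (3 * l) • K2] := by
  have hl1 : 1 ≤ l := by
    by_contra h0
    exact hl ⟨1, by have : l = 0 := by omega
                    simp [this]⟩
  refine hasExactlyMates_of ?_ ?_ fun B hB => ?_
  · simpa using not_iso_graphR_graphQ hl1 (3 * l)
  · simpa using ⟨isMate_graphR hl1, isMate_graphQ hl1⟩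
  · rcases hB.cases (by omega) with ⟨n, hn, hk, h⟩ | ⟨n, hn, hk, h⟩ | ⟨d, hd, hk, h | h⟩ | ⟨hk, h⟩ |
      ⟨hk, h⟩ | ⟨hk, h⟩ | ⟨hk, h⟩
    · exfalso
      -- For even `n` the number `n (n + 2)` is divisible by `4`; for `n = 2m + 1` the equation
      -- gives `l = (m + 1)² - 1`, which is excluded.
      rcases Nat.even_or_odd' n with ⟨m, rfl | rfl⟩
      · have : 2 * m * (2 * m + 2) = 4 * (m * (m + 1)) := by ring
        omega
      · refine hl ⟨m + 1, ?_⟩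
        have : (4 * l + 3 : ℤ) = (2 * m + 1) * (2 * m + 1 + 2) := by exact_mod_cast hk
        linarith
    · have := Nat.even_mul_succ_self n
      rw [← hk] at this
      obtain ⟨m, hm⟩ := this
      omega
    · obtain rfl : d = l := by omega
      exact ⟨_, by simp, h⟩
    · obtain rfl : d = l := by omega
      exact ⟨_, by simp, h⟩
    · omega
    · exact absurd ⟨2, by have : l = 3 := by omega
                          simp [this]⟩ hl
    all_goals omega

theorem mul_add_two_injective {m n : ℕ} (h : m * (m + 2) = n * (n + 2)) : m = n := by
  rcases lt_trichotomy m n with h1 | h1 | h1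
  · nlinarith
  · exact h1
  · nlinarith

/-- The number `m (m + 2)` lies strictly between `m (m + 1)` and `(m + 1)(m + 2)`. Hence no `k`
admits mates of both types `L` and `H`. -/
theorem mul_add_two_ne_mul_add_one {m n : ℕ} (hm : 1 ≤ m) : m * (m + 2) ≠ n * (n + 1) := by
  intro h
  rcases Nat.lt_or_ge m n with h1 | h1 <;> nlinarith

theorem mul_add_one_injective {m n : ℕ} (h : m * (m + 1) = n * (n + 1)) : m = n := by
  rcases lt_trichotomy m n with h1 | h1 | h1
  · nlinarith
  · exact h1
  · nlinarith

theorem hasExactlyMates_sq_sub_one_even {k l t : ℕ} (hl : 2 ≤ l) (hk : k = l ^ 2 - 1)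
    (hlt : l = 2 * t) (h3 : k ≠ 3) (h15 : k ≠ 15) : (graphS k).HasExactlyMates
      [graphL (l + 1) + (k - l - 1) • K2 + K1, graphR (t ^ 2 + 2) + (3 * (t ^ 2 - 1)) • K2,
        graphQ (t ^ 2 + 2) + (3 * (t ^ 2 - 1)) • K2] := by
  obtain ⟨n, rfl⟩ : ∃ n, l = n + 1 := ⟨l - 1, by omega⟩
  obtain ⟨d, hd⟩ : ∃ d, t ^ 2 = d + 1 := ⟨t ^ 2 - 1, by
    have : 0 < t := by omega
    have := Nat.pow_pos (n := 2) this
    omega⟩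
  have hkn : k = n * (n + 2) := by rw [hk]; ring_nf; omega
  have hkd : k = 4 * d + 3 := by rw [hk, hlt, mul_pow, hd]; omega
  -- Here `k ≠ 3` is used. Since `k = 4d + 3` and `k ≠ 15`, none of the sporadic graphs occurs.
  have hd1 : 1 ≤ d := by omega
  have e1 : k - (n + 1) - 1 = k - (n + 2) := by omega
  rw [hd, e1, Nat.add_sub_cancel]
  refine hasExactlyMates_of ?_ ?_ fun B hB => ?_
  · simp only [List.pairwise_cons, List.mem_cons, List.not_mem_nil, or_false, forall_eq_or_imp,
      forall_eq, List.Pairwise.nil, and_true, false_imp_iff, implies_true]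
    exact ⟨⟨not_iso_graphR_of_hasIsolated (hasIsolated_graphL _ _) hd1 _,
      not_iso_graphQ_of_hasIsolated (hasIsolated_graphL _ _) hd1 _⟩,
      not_iso_graphR_graphQ hd1 _⟩
  · have hL := isMate_graphL (n := n) (by omega)
    have hR := isMate_graphR hd1
    have hQ := isMate_graphQ hd1
    rw [← hkn] at hL
    rw [← hkd] at hR hQ
    simpa using ⟨hL, hR, hQ⟩
  · rcases hB.cases (by omega) with ⟨m, hm, hkm, h⟩ | ⟨m, hm, hkm, h⟩ | ⟨d', hd', hk', h | h⟩ |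
      ⟨hk, h⟩ | ⟨hk, h⟩ | ⟨hk, h⟩ | ⟨hk, h⟩
    · obtain rfl : n = m := mul_add_two_injective (hkn.symm.trans hkm)
      exact ⟨_, by simp, h⟩
    · exact absurd (hkn.symm.trans hkm) (mul_add_two_ne_mul_add_one (by omega))
    · obtain rfl : d' = d := by omega
      exact ⟨_, by simp, h⟩
    · obtain rfl : d' = d := by omega
      exact ⟨_, by simp, h⟩
    all_goals omega

theorem hasExactlyMates_sq_sub_one_odd {k l : ℕ} (hl : 2 ≤ l) (hk : k = l ^ 2 - 1) (hodd : Odd l)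
    (h8 : k ≠ 8) : (graphS k).HasExactlyMates [graphL (l + 1) + (k - l - 1) • K2 + K1] := by
  obtain ⟨n, rfl⟩ : ∃ n, l = n + 1 := ⟨l - 1, by omega⟩
  have hkn : k = n * (n + 2) := by rw [hk]; ring_nf; omega
  -- Divisibility by `4` rules out `R`, `Q` and every sporadic value except `8`, which is excluded
  -- by hypothesis.
  have h4 : ∃ c, k = 4 * c := by
    obtain ⟨m, hm⟩ := hodd
    obtain rfl : n = 2 * m := by omega
    exact ⟨m * (m + 1), by rw [hkn]; ring⟩
  obtain ⟨c, hc⟩ := h4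
  have e1 : k - (n + 1) - 1 = k - (n + 2) := by omega
  have hk1 : 1 ≤ k := by rw [hkn]; exact Nat.mul_pos (by omega) (by omega)
  rw [e1]
  refine hasExactlyMates_of (by simp) ?_ fun B hB => ?_
  · have hL := isMate_graphL (n := n) (by omega)
    rw [← hkn] at hL
    simpa using hL
  · rcases hB.cases hk1 with ⟨m, hm, hkm, h⟩ | ⟨m, hm, hkm, h⟩ | ⟨d', hd', hk', h⟩ |
      ⟨hk, h⟩ | ⟨hk, h⟩ | ⟨hk, h⟩ | ⟨hk, h⟩
    · obtain rfl : n = m := mul_add_two_injective (hkn.symm.trans hkm)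
      exact ⟨_, by simp, h⟩
    · exact absurd (hkn.symm.trans hkm) (mul_add_two_ne_mul_add_one (by omega))
    all_goals omega

theorem hasExactlyMates_sq_sub_self {k l : ℕ} (hl : 3 ≤ l) (hk : k = l ^ 2 - l) :
    (graphS k).HasExactlyMates [graphH l + (k - l) • K2] := by
  obtain ⟨n, rfl⟩ : ∃ n, l = n + 1 := ⟨l - 1, by omega⟩
  have hkn : k = n * (n + 1) := by rw [hk, sq, ← Nat.sub_one_mul]; rfl
  have hk1 : 1 ≤ k := by rw [hkn]; exact Nat.mul_pos (by omega) (by omega)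
  -- Evenness of `k` rules out `4d + 3`, `15` and `17`; the values `8` and `14` are not products of
  -- consecutive integers.
  obtain ⟨c, hc⟩ := Nat.even_mul_succ_self n
  rw [← hkn] at hc
  refine hasExactlyMates_of (by simp) ?_ fun B hB => ?_
  · have hH := isMate_graphH (n := n) (by omega)
    rw [← hkn] at hH
    simpa using hH
  · rcases hB.cases hk1 with ⟨m, hm, hkm, h⟩ | ⟨m, hm, hkm, h⟩ | ⟨d', hd', hk', h⟩ |
      ⟨hk, h⟩ | ⟨hk, h⟩ | ⟨hk, h⟩ | ⟨hk, h⟩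
    · exact absurd (hkm.symm.trans hkn) (mul_add_two_ne_mul_add_one hm)
    · obtain rfl : n = m := mul_add_one_injective (hkn.symm.trans hkm)
      exact ⟨_, by simp, h⟩
    · omega
    · rw [hk] at hkn
      have : n < 3 := by nlinarith
      interval_cases n <;> omega
    · omega
    · omega
    · rw [hk] at hkn
      have : n < 4 := by nlinarith
      interval_cases n <;> omega

end FinGraph

theorem mainTheorem6 :
    (∀ k : ℕ, 1 ≤ k → ((FinGraph.graphS k).IsDS ↔ k ∉ FinGraph.exceptionalSet)) ∧
    (FinGraph.graphS 3).HasExactlyMates [FinGraph.graphL 3 + FinGraph.K1] ∧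
    (FinGraph.graphS 8).HasExactlyMates
      [FinGraph.graphL 4 + 4 • FinGraph.K2 + FinGraph.K1,
       FinGraph.graphG1 + 3 • FinGraph.K2 + FinGraph.K1] ∧
    (FinGraph.graphS 14).HasExactlyMates [FinGraph.graphG4 + 9 • FinGraph.K2] ∧
    (FinGraph.graphS 15).HasExactlyMates
      [FinGraph.graphG2 + 9 • FinGraph.K2 + FinGraph.K1,
       FinGraph.graphL 5 + 10 • FinGraph.K2 + FinGraph.K1,
       FinGraph.graphR 6 + 9 • FinGraph.K2,
       FinGraph.graphQ 6 + 9 • FinGraph.K2] ∧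
    (FinGraph.graphS 17).HasExactlyMates [FinGraph.graphG3 + 12 • FinGraph.K2] ∧
    (∀ k l : ℕ, k = 4 * l + 3 → (¬ ∃ t : ℤ, (l : ℤ) = t ^ 2 - 1) →
      (FinGraph.graphS k).HasExactlyMates
        [FinGraph.graphR (l + 3) + (3 * l) • FinGraph.K2,
         FinGraph.graphQ (l + 3) + (3 * l) • FinGraph.K2]) ∧
    (∀ k l t : ℕ, 2 ≤ l → k = l ^ 2 - 1 → l = 2 * t → k ≠ 3 → k ≠ 15 →
      (FinGraph.graphS k).HasExactlyMates
        [FinGraph.graphL (l + 1) + (k - l - 1) • FinGraph.K2 + FinGraph.K1,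
         FinGraph.graphR (t ^ 2 + 2) + (3 * (t ^ 2 - 1)) • FinGraph.K2,
         FinGraph.graphQ (t ^ 2 + 2) + (3 * (t ^ 2 - 1)) • FinGraph.K2]) ∧
    (∀ k l : ℕ, 2 ≤ l → k = l ^ 2 - 1 → Odd l → k ≠ 8 →
      (FinGraph.graphS k).HasExactlyMates
        [FinGraph.graphL (l + 1) + (k - l - 1) • FinGraph.K2 + FinGraph.K1]) ∧
    (∀ k l : ℕ, 3 ≤ l → k = l ^ 2 - l →
      (FinGraph.graphS k).HasExactlyMates
        [FinGraph.graphH l + (k - l) • FinGraph.K2]) := by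
  exact ⟨fun k hk => FinGraph.isDS_graphS_iff hk, FinGraph.hasExactlyMates_three,
    FinGraph.hasExactlyMates_eight, FinGraph.hasExactlyMates_fourteen,
    FinGraph.hasExactlyMates_fifteen, FinGraph.hasExactlyMates_seventeen,
    fun _ _ hk hl => hk ▸ FinGraph.hasExactlyMates_four_mul_add_three hl,
    fun _ _ _ hl hk hlt h3 h15 => FinGraph.hasExactlyMates_sq_sub_one_even hl hk hlt h3 h15,
    fun _ _ hl hk hodd h8 => FinGraph.hasExactlyMates_sq_sub_one_odd hl hk hodd h8,
    fun _ _ hl hk => FinGraph.hasExactlyMates_sq_sub_self hl hk⟩
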